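/- Let $\varphi_i(x)=A_ix+c_i$, $i=1,\dots,\kappa$, be affine maps of $\mathbb{R}^2$ with $A_i$ invertible and $\|A_i\|<1$, and let $E$ be the self-affine set of the system, i.e. the unique nonempty compact set with $E=\bigcup_{i=1}^\kappa\varphi_i(E)$. For a finite word $\mathtt{i}=(i_1,\dots,i_n)$ put $A_{\mathtt i}=A_{i_1}\cdots A_{i_n}$ and $\varphi_{\mathtt i}=\varphi_{i_1}\circ\cdots\circ\varphi_{i_n}$, and if $A_{\mathtt i}(B(0,1))$ is not a ball let $\vartheta_1(\mathtt i)\in\mathbb{P}^1$ be the line spanned by the longer semiaxis of the ellipse $A_{\mathtt i}(B(0,1))$. For $\mathtt i\in\Sigma=\{1,\dots,\kappa\}^{\mathbb N}$ let $\vartheta_1(\mathtt i)=\lim_{n\to\infty}\vartheta_1(\mathtt i|_n)$, where $\mathtt i|_n$ consists of the first $n$ symbols of $\mathtt i$ and distances in $\mathbb{P}^1$ are angles between lines; let $\vartheta_1(\Sigma)$ be the set of all such limits. For a unit vector $e\in S^1$ let $\langle e\rangle\in\mathbb{P}^1$ be the line it spans, let $\mathrm{proj}^e$ be the orthogonal projection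 along $e$ (onto $e^\perp$), and let $\mathrm{vis}^e(E)$ be the visible part of $E$ in direction $e$, i.e. the set of all $x$ with $(\{x\}+\{te:t\ge 0\})\cap E=\{x\}$. Assume (projection condition) $\mathbb{P}^1\setminus\vartheta_1(\Sigma)\neq\emptyset$, and for every $e\in S^1$ with $\langle e\rangle\notin\vartheta_1(\Sigma)$ there is $n_0$ such that $\mathrm{proj}^e\varphi_{\mathtt i}(E)$ is a nondegenerate interval for all words $\mathtt i$ of length $n\ge n_0$; (strong cone separation) there is a closed cone $X$, consisting of all lines through the origin that make an angle at most $\omega$ with some fixed line, where $0<\omega<\pi/2$, such that, regarding $X$ as a subset of $\mathbb{P}^1$, $A_i(X)\subset\mathrm{int}(X)$ and $A_i^T(X)\subset\mathrm{int}(X)$ for all $i$, and $A_i(X)\cap A_j(X)=\emptyset$ for all $i\ne j$. Then $$\dim_H \mathrm{vis}^e(E)=\dim_A \mathrm{vis}^e(E)=1$$ for Lebesgue-almost every $e\in S^1$ (with respect to arc length), where $\dim_H$ and $\dim_A$ denote Hausdorff and Assouad dimension. -/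

import Mathlib

open Set Filter Topology MeasureTheory
open scoped NNReal ENNReal LinearAlgebra.Projectivization

noncomputable section

namespace SelfAffine

/-- The Euclidean plane. -/
abbrev Plane : Type := EuclideanSpace ℝ (Fin 2)

/-- The unit circle, as the set of directions. -/
abbrev Circ : Type := Metric.sphere (0 : Plane) 1

/-! ### Lines through the origin -/

/-- The angle, in `[0, π / 2]`, between the lines spanned by two nonzero vectors. -/
def vecLineAngle (u v : Plane) : ℝ :=
  min (InnerProductGeometry.angle u v) (Real.pi - InnerProductGeometry.angle u v)

/-- The distance of the projective line: the angle between two lines through the origin. -/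
def lineAngle (p q : ℙ ℝ Plane) : ℝ := vecLineAngle p.rep q.rep

theorem vecLineAngle_comm (u v : Plane) : vecLineAngle u v = vecLineAngle v u := by
  unfold vecLineAngle
  rw [InnerProductGeometry.angle_comm]

theorem vecLineAngle_smul_right (u v : Plane) {a : ℝ} (ha : a ≠ 0) :
    vecLineAngle u (a • v) = vecLineAngle u v := by
  unfold vecLineAngle
  rcases lt_or_gt_of_ne ha with h | h
  · rw [InnerProductGeometry.angle_smul_right_of_neg u v h, InnerProductGeometry.angle_neg_right,
      sub_sub_cancel, min_comm]
  · rw [InnerProductGeometry.angle_smul_right_of_pos u v h]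

/-- The angle between two lines may be computed with any nonzero vectors on them. -/
theorem lineAngle_mk_mk (u v : Plane) (hu : u ≠ 0) (hv : v ≠ 0) :
    lineAngle (Projectivization.mk ℝ u hu) (Projectivization.mk ℝ v hv) = vecLineAngle u v := by
  obtain ⟨a, ha⟩ := Projectivization.exists_smul_eq_mk_rep ℝ u hu
  obtain ⟨b, hb⟩ := Projectivization.exists_smul_eq_mk_rep ℝ v hv
  unfold lineAngle
  rw [← ha, ← hb, Units.smul_def, Units.smul_def, vecLineAngle_smul_right _ _ b.ne_zero,
    vecLineAngle_comm, vecLineAngle_smul_right _ _ a.ne_zero, vecLineAngle_comm]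

/-- The line `⟨e⟩` spanned by a direction `e`. -/
def dirLine (e : Circ) : ℙ ℝ Plane :=
  Projectivization.mk ℝ (e : Plane) (ne_zero_of_mem_unit_sphere e)

/-- `p` is the orientation of the longer semiaxis of the ellipse `A (B (0, 1))`, which is required
not to be a ball: `p = ⟨A η⟩` for a unit vector `η` with `Aᵀ A η = α₁(A)² η`, and
`α₂(A) < α₁(A)`, where `α₁(A) ≥ α₂(A)` are the square roots of the eigenvalues of `Aᵀ A`. -/
def IsLongAxis (A : Plane ≃L[ℝ] Plane) (p : ℙ ℝ Plane) : Prop :=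
  (A : Plane →ₗ[ℝ] Plane).singularValues 1 < (A : Plane →ₗ[ℝ] Plane).singularValues 0 ∧
  ∃ η : Plane, ‖η‖ = 1 ∧
    (A : Plane →L[ℝ] Plane).adjoint (A η)
      = ((A : Plane →ₗ[ℝ] Plane).singularValues 0) ^ 2 • η ∧
    ∃ hη : A η ≠ 0, p = Projectivization.mk ℝ (A η) hη

/-! ### Affine iterated function systems -/

/-- A finite family of affine maps `φ_i x = A_i x + c_i` of the plane, `A_i` being invertible and
contractive in the Euclidean operator norm. -/
structure AffineIFS (κ : ℕ) where
  /-- the linear parts `A_i` -/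
  lin : Fin κ → (Plane ≃L[ℝ] Plane)
  /-- the translation vectors `c_i` -/
  trans : Fin κ → Plane
  contractive : ∀ i, ‖(lin i : Plane →L[ℝ] Plane)‖ < 1

namespace AffineIFS

variable {κ : ℕ} (S : AffineIFS κ)

/-- The affine map `φ_i x = A_i x + c_i`. -/
def map (i : Fin κ) (x : Plane) : Plane := S.lin i x + S.trans i

/-- `E` is the self-affine set of the system: the nonempty compact set with `E = ⋃ i, φ_i (E)`. -/
def IsSelfAffineSet (E : Set Plane) : Prop :=
  E.Nonempty ∧ IsCompact E ∧ E = ⋃ i, S.map i '' E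

/-- `A_w = A_{w₁} A_{w₂} ⋯ A_{wₙ}` for a finite word `w`. -/
def linWord : List (Fin κ) → (Plane ≃L[ℝ] Plane)
  | [] => ContinuousLinearEquiv.refl ℝ Plane
  | i :: w => (linWord w).trans (S.lin i)

/-- `φ_w = φ_{w₁} ∘ φ_{w₂} ∘ ⋯ ∘ φ_{wₙ}` for a finite word `w`. -/
def mapWord : List (Fin κ) → Plane → Plane
  | [] => id
  | i :: w => S.map i ∘ mapWord w

end AffineIFS

/-- The word formed by the first `n` symbols of an infinite word. -/
def prefixWord {κ : ℕ} (i : ℕ → Fin κ) (n : ℕ) : List (Fin κ) :=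
  List.ofFn fun k : Fin n => i k

namespace AffineIFS

variable {κ : ℕ} (S : AffineIFS κ)

/-- `p` is the limit orientation of the infinite word `i`: the orientations of the longer
semiaxes of `A_{i|n} (B (0, 1))` are defined for all large `n` and converge to `p`. -/
def IsLimitOrientation (i : ℕ → Fin κ) (p : ℙ ℝ Plane) : Prop :=
  ∃ q : ℕ → ℙ ℝ Plane,
    (∀ᶠ n in atTop, IsLongAxis (S.linWord (prefixWord i n)) (q n)) ∧
    Tendsto (fun n => lineAngle (q n) p) atTop (𝓝 0)

/-- The set of the limit orientations of all infinite words. -/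
def limitOrientations : Set (ℙ ℝ Plane) :=
  {p | ∃ i : ℕ → Fin κ, S.IsLimitOrientation i p}

end AffineIFS

/-- The orthogonal projection along the direction `e`, onto the line orthogonal to `e`. -/
def projAlong (e : Circ) : Plane →L[ℝ] Plane :=
  (Submodule.span ℝ {(e : Plane)})ᗮ.starProjection

namespace AffineIFS

variable {κ : ℕ} (S : AffineIFS κ)

/-- The projection condition: some line is not a limit orientation, and for every direction `e`
whose line is not a limit orientation, the projections along `e` of all cylinders `φ_w (E)` of
sufficiently high level are nondegenerate intervals. -/
def ProjectionCondition (E : Set Plane) : Prop :=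
  (S.limitOrientations)ᶜ.Nonempty ∧
  ∀ e : Circ, dirLine e ∉ S.limitOrientations →
    ∃ n₀ : ℕ, ∀ w : List (Fin κ), n₀ ≤ w.length →
      ∃ a b : Plane, a ≠ b ∧ projAlong e '' (S.mapWord w '' E) = segment ℝ a b

end AffineIFS

/-- The closed cone about the line `m` with angle `ω`: all lines through the origin that make an
angle at most `ω` with `m`. The origin is left out, so that two cones are disjoint precisely when
they have no line in common. -/
def cone (m : ℙ ℝ Plane) (ω : ℝ) : Set Plane :=
  {x | ∃ hx : x ≠ 0, lineAngle m (Projectivization.mk ℝ x hx) ≤ ω}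

/-- The strong cone separation: some cone `X` is mapped into its interior by all `A_i` and all
`A_iᵀ`, and the cones `A_i (X)` are pairwise disjoint. -/
def AffineIFS.StrongConeSeparation {κ : ℕ} (S : AffineIFS κ) : Prop :=
  ∃ (m : ℙ ℝ Plane) (ω : ℝ), 0 < ω ∧ ω < Real.pi / 2 ∧
    (∀ i, S.lin i '' cone m ω ⊆ interior (cone m ω)) ∧
    (∀ i, (S.lin i : Plane →L[ℝ] Plane).adjoint '' cone m ω ⊆ interior (cone m ω)) ∧
    ∀ i j, i ≠ j → (S.lin i '' cone m ω) ∩ (S.lin j '' cone m ω) = ∅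

/-! ### Visible parts and the Assouad dimension -/

/-- The half line from the origin in the direction `e`. -/
def halfLine (e : Circ) : Set Plane := {y | ∃ t : ℝ, 0 ≤ t ∧ y = t • (e : Plane)}

/-- The visible part of `E` in the direction `e`: the points `x` with
`({x} + ℓ(e)) ∩ E = {x}`. -/
def visiblePart (e : Circ) (E : Set Plane) : Set Plane :=
  {x | (fun y => x + y) '' halfLine e ∩ E = {x}}

/-- `s` is an admissible exponent for the Assouad dimension of `F`: for a constant `C`, every set
`F ∩ B(x, R)` with `x ∈ F` can be covered by at most `C (R / r) ^ s` balls of radius `r`,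
for all `0 < r < R`. -/
def IsAssouadExponent {X : Type*} [MetricSpace X] (F : Set X) (s : ℝ≥0) : Prop :=
  ∃ C : ℝ, ∀ x ∈ F, ∀ r R : ℝ, 0 < r → r < R →
    ∃ t : Finset X, F ∩ Metric.closedBall x R ⊆ ⋃ y ∈ t, Metric.closedBall y r ∧
      (t.card : ℝ) ≤ C * (R / r) ^ (s : ℝ)

/-- The Assouad dimension: the infimum of the admissible exponents (`∞` if there is none). -/
def assouadDim {X : Type*} [MetricSpace X] (F : Set X) : ℝ≥0∞ :=
  ⨅ (s : ℝ≥0) (_ : IsAssouadExponent F s), (s : ℝ≥0∞)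

end SelfAffine

end

/-! In orthonormal coordinates along the axis of the cone the matrices act on slopes by Möbius maps.
The transposed cone condition allows the cone to be taken of slope `τ ≤ 1`. An image cone `A_w(X)`
is then an interval of slopes. Its subcones `A_{wi}(X)` are disjoint and lie in the image of the
smaller cone of slope `τ₁ < τ`, so their total length is at most `θ = τ₁ / τ` times that of the
parent (`ConeSystem.sum_len_le`). The set of limit slopes is therefore null. It contains the slope
of every limit orientation, so almost every `e` avoids it (`ae_forall_slope_ne`), and for such `e`
the projection condition applies.

Fix such an `e`, and let `T` and `h` be the coordinates across and along `e`. The estimate `|det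
A_w| ≤ θ ^ n * p ^ 2`, with `p` the modulus of the upper left entry of `A_w`, makes a long cylinder
a strip of length about `p` and width `o(p)`. Its slope is uniformly transversal to `e`, and its
projection along `e` is an interval. At scale `R` every point of `E` thus lies in a cylinder that is
a Lipschitz graph over an interval of `T`-length at least `4R`, up to an error `ρR` with `ρ` as
small as desired and a Lipschitz constant independent of `ρ` (`exists_graphPiece`).

A visible point is the highest point of `E` on its line parallel to `e`. Hence a visible point
cannot lie far below the graph piece of another one, so `h` plus a multiple of `T` is almost
increasing along the visible points whose pieces extend to the same side. This gives a cover of `vis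
∩ B(x, R)` by `O(1 / ρ)` balls of radius `ρR` (`exists_finset_cover_of_graphPieces`). Iterating at
one fixed small `ρ` gives Assouad dimension at most 1. The lower bound holds because the visible
part and `E` have the same projection along `e`, which contains an interval. -/

namespace SelfAffine

/-! ### Coverings and dimensions in metric spaces -/

section Coverings

variable {X : Type*} [MetricSpace X]

/-- Pigeonhole: cut the range of `U` into steps of length `δ` and keep one point of `B` per occupied
step. Centres inside the set are what allows covers to be refined later. -/
theorem exists_finset_cover_of_bounded_function {B : Set X} {U : X → ℝ} {a L δ r : ℝ} (hδ : 0 < δ)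
    (hL : 0 ≤ L) (hU : ∀ x ∈ B, a ≤ U x ∧ U x ≤ a + L)
    (h : ∀ x ∈ B, ∀ y ∈ B, |U x - U y| ≤ δ → dist x y ≤ r) :
    ∃ T : Finset X, (T : Set X) ⊆ B ∧ B ⊆ ⋃ y ∈ T, Metric.closedBall y r ∧
      (T.card : ℝ) ≤ L / δ + 1 := by
  classical
  let k : X → ℕ := fun x => ⌊(U x - a) / δ⌋₊
  have hk : k '' B ⊆ (Finset.range (⌊L / δ⌋₊ + 1) : Finset ℕ) := by
    rintro _ ⟨x, hx, rfl⟩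
    simp only [Finset.coe_range, mem_Iio, k, Nat.lt_succ_iff]
    apply Nat.floor_le_floor
    gcongr
    linarith [(hU x hx).2]
  have hfin : (k '' B).Finite := (Finset.finite_toSet _).subset hk
  rcases B.eq_empty_or_nonempty with rfl | ⟨x₀, hx₀⟩
  · exact ⟨∅, by simp, by simp, by simp; positivity⟩
  have : Nonempty X := ⟨x₀⟩
  choose! g hgB hgk using fun (n : ℕ) (hn : n ∈ k '' B) => hn
  refine ⟨hfin.toFinset.image g, ?_, ?_, ?_⟩
  · intro y hy
    simp only [Finset.coe_image, Finite.coe_toFinset, mem_image (f := g)] at hy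
    obtain ⟨n, hn, rfl⟩ := hy
    exact hgB n hn
  · intro x hx
    have hkx : k x ∈ k '' B := mem_image_of_mem k hx
    simp only [mem_iUnion]
    refine ⟨g (k x), Finset.mem_image_of_mem _ (by simpa using hkx), ?_⟩
    rw [Metric.mem_closedBall]
    apply h _ hx _ (hgB _ hkx)
    have e := hgk _ hkx
    have hx0 : 0 ≤ (U x - a) / δ := div_nonneg (by linarith [(hU x hx).1]) hδ.le
    have hy0 : 0 ≤ (U (g (k x)) - a) / δ :=
      div_nonneg (by linarith [(hU _ (hgB _ hkx)).1]) hδ.le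
    have h1 := Nat.floor_le hx0
    have h2 := Nat.lt_floor_add_one ((U x - a) / δ)
    have h3 := Nat.floor_le hy0
    have h4 := Nat.lt_floor_add_one ((U (g (k x)) - a) / δ)
    have e' : (⌊(U (g (k x)) - a) / δ⌋₊ : ℝ) = ⌊(U x - a) / δ⌋₊ := by exact_mod_cast e
    rw [e'] at h3 h4
    have h5 : (U x - a) / δ - (U (g (k x)) - a) / δ = (U x - U (g (k x))) / δ := by ring
    have h6 : |(U x - U (g (k x))) / δ| ≤ 1 := by
      rw [← h5, abs_le]; constructor <;> linarith
    rwa [abs_div, abs_of_pos hδ, div_le_one hδ] at h6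
  · have hc : (hfin.toFinset.image g).card ≤ ⌊L / δ⌋₊ + 1 := by
      refine Finset.card_image_le.trans ?_
      have : hfin.toFinset ⊆ Finset.range (⌊L / δ⌋₊ + 1) := by
        intro n hn
        have := hk ((Set.Finite.mem_toFinset hfin).1 hn)
        simpa using this
      simpa using Finset.card_le_card this
    calc ((hfin.toFinset.image g).card : ℝ) ≤ ((⌊L / δ⌋₊ + 1 : ℕ) : ℝ) := by exact_mod_cast hc
      _ ≤ L / δ + 1 := by
        push_cast
        have := Nat.floor_le (div_nonneg hL hδ.le)
        linarith

theorem exists_finset_cover_trans {A F : Set X} {r r' N N' : ℝ} (hN' : 0 ≤ N')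
    (hA : A ⊆ F) (T : Finset X) (hTF : (T : Set X) ⊆ F)
    (hT : A ⊆ ⋃ y ∈ T, Metric.closedBall y r) (hcard : (T.card : ℝ) ≤ N)
    (h : ∀ y ∈ F, ∃ T' : Finset X, (T' : Set X) ⊆ F ∧
      F ∩ Metric.closedBall y r ⊆ ⋃ z ∈ T', Metric.closedBall z r' ∧ (T'.card : ℝ) ≤ N') :
    ∃ T' : Finset X, (T' : Set X) ⊆ F ∧ A ⊆ ⋃ z ∈ T', Metric.closedBall z r' ∧
      (T'.card : ℝ) ≤ N * N' := by
  classical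
  choose! G hGF hG hGc using h
  refine ⟨T.biUnion G, ?_, ?_, ?_⟩
  · intro z hz
    simp only [Finset.coe_biUnion, mem_iUnion] at hz
    obtain ⟨y, hy, hz⟩ := hz
    exact hGF y (hTF hy) hz
  · intro x hx
    have := hT hx
    simp only [mem_iUnion] at this
    obtain ⟨y, hy, hxy⟩ := this
    have := hG y (hTF hy) ⟨hA hx, hxy⟩
    simp only [mem_iUnion] at this ⊢
    obtain ⟨z, hz, hxz⟩ := this
    exact ⟨z, Finset.mem_biUnion.2 ⟨y, hy, hz⟩, hxz⟩
  · calc ((T.biUnion G).card : ℝ) ≤ ((∑ y ∈ T, (G y).card : ℕ) : ℝ) := by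
          exact_mod_cast Finset.card_biUnion_le
      _ = ∑ y ∈ T, ((G y).card : ℝ) := by push_cast; rfl
      _ ≤ ∑ y ∈ T, N' := Finset.sum_le_sum fun y hy => hGc y (hTF hy)
      _ = T.card * N' := by simp
      _ ≤ N * N' := by gcongr

/-- A covering estimate at a single small ratio `ρ` iterates to an Assouad exponent. -/
theorem isAssouadExponent_of_single_ratio {F : Set X} (hF : TotallyBounded F) {ρ R₀ : ℝ} {s : ℝ≥0}
    (hρ : 0 < ρ) (hρ1 : ρ < 1) (hR₀ : 0 < R₀)
    (h : ∀ R, 0 < R → R ≤ R₀ → ∀ x ∈ F, ∃ T : Finset X, (T : Set X) ⊆ F ∧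
      F ∩ Metric.closedBall x R ⊆ ⋃ y ∈ T, Metric.closedBall y (ρ * R) ∧
      (T.card : ℝ) ≤ (ρ ^ (s : ℝ))⁻¹) :
    IsAssouadExponent F s := by
  set N : ℝ := (ρ ^ (s : ℝ))⁻¹ with hN
  have hN1 : 1 ≤ N := (one_le_inv₀ (Real.rpow_pos_of_pos hρ _)).2
    (Real.rpow_le_one hρ.le hρ1.le s.coe_nonneg)
  have hN0 : 0 < N := by linarith
  -- The centres stay in `F`, so the hypothesis applies again to each ball of the cover.
  have iter : ∀ n : ℕ, ∀ R, 0 < R → R ≤ R₀ → ∀ x ∈ F, ∃ T : Finset X, (T : Set X) ⊆ F ∧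
      F ∩ Metric.closedBall x R ⊆ ⋃ y ∈ T, Metric.closedBall y (ρ ^ n * R) ∧
      (T.card : ℝ) ≤ N ^ n := by
    intro n
    induction n with
    | zero =>
      intro R _ _ x hx
      exact ⟨{x}, by simpa using hx, by simp, by simp⟩
    | succ n ih =>
      intro R hR hR' x hx
      obtain ⟨T, hTF, hT, hTc⟩ := ih R hR hR' x hx
      have hle : ρ ^ n * R ≤ R₀ :=
        (mul_le_of_le_one_left hR.le (pow_le_one₀ hρ.le hρ1.le)).trans hR'
      obtain ⟨T', h1, h2, h3⟩ := exists_finset_cover_trans hN0.le inter_subset_left T hTF hT hTc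
        (fun y hy => h (ρ ^ n * R) (by positivity) hle y hy)
      refine ⟨T', h1, ?_, ?_⟩
      · rwa [← mul_assoc, ← pow_succ'] at h2
      · rwa [← pow_succ] at h3
  have small : ∀ R, 0 < R → R ≤ R₀ → ∀ r, 0 < r → r < R → ∀ x ∈ F, ∃ T : Finset X,
      (T : Set X) ⊆ F ∧ F ∩ Metric.closedBall x R ⊆ ⋃ y ∈ T, Metric.closedBall y r ∧
      (T.card : ℝ) ≤ N * (R / r) ^ (s : ℝ) := by
    intro R hR hR' r hr hrR x hx
    -- Rounding `r / R` down to a power of `ρ` costs a single extra factor `N`.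
    obtain ⟨n, hn1, hn2⟩ := exists_nat_pow_near_of_lt_one (div_pos hr hR)
      ((div_le_one hR).2 hrR.le) hρ hρ1
    obtain ⟨T, h1, h2, h3⟩ := iter (n + 1) R hR hR' x hx
    refine ⟨T, h1, h2.trans ?_, h3.trans ?_⟩
    · refine iUnion₂_mono fun y _ => Metric.closedBall_subset_closedBall ?_
      exact ((lt_div_iff₀ hR).1 hn1).le
    · rw [pow_succ']
      gcongr
      have h4 : (ρ ^ n)⁻¹ ≤ R / r := by
        rw [← inv_div r R]
        exact inv_anti₀ (div_pos hr hR) hn2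
      calc N ^ n = ((ρ ^ n)⁻¹) ^ (s : ℝ) := by
            rw [hN, inv_pow, ← Real.rpow_natCast, ← Real.rpow_mul hρ.le, mul_comm,
              Real.rpow_mul hρ.le, Real.rpow_natCast, Real.inv_rpow (by positivity)]
        _ ≤ (R / r) ^ (s : ℝ) := Real.rpow_le_rpow (by positivity) h4 s.coe_nonneg
  obtain ⟨t, htF, htfin, ht⟩ := totallyBounded_iff_subset.1 hF _ (Metric.dist_mem_uniformity hR₀)
  have ht' : F ⊆ ⋃ y ∈ htfin.toFinset, Metric.closedBall y R₀ := by
    intro x hx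
    have := ht hx
    simp only [mem_iUnion] at this ⊢
    obtain ⟨y, hy, hxy⟩ := this
    exact ⟨y, by simpa using hy, Metric.mem_closedBall.2 (le_of_lt hxy)⟩
  have htF' : (htfin.toFinset : Set X) ⊆ F := by simpa using htF
  set M : ℝ := (htfin.toFinset.card : ℝ) with hM
  have hM0 : 0 ≤ M := Nat.cast_nonneg _
  -- For `R > R₀` one starts from the `M` balls of radius `R₀` that cover all of `F`; the summand 1
  -- accommodates `R ≤ R₀`.
  refine ⟨(M + 1) * N, fun x hx r R hr hrR => ?_⟩
  have hR : 0 < R := hr.trans hrR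
  have hRr : 1 ≤ (R / r) ^ (s : ℝ) :=
    Real.one_le_rpow ((one_le_div hr).2 hrR.le) s.coe_nonneg
  rcases le_or_gt R R₀ with hRR | hRR
  · obtain ⟨T, -, h2, h3⟩ := small R hR hRR r hr hrR x hx
    refine ⟨T, h2, h3.trans ?_⟩
    gcongr
    nlinarith
  rcases lt_or_ge r R₀ with hrR0 | hrR0
  · obtain ⟨T', -, h2, h3⟩ := exists_finset_cover_trans (N' := N * (R₀ / r) ^ (s : ℝ))
      (by positivity) (inter_subset_left (s := F) (t := Metric.closedBall x R)) htfin.toFinset htF'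
      (inter_subset_left.trans ht') le_rfl (fun y hy => small R₀ hR₀ le_rfl r hr hrR0 y hy)
    refine ⟨T', h2, h3.trans ?_⟩
    rw [← mul_assoc]
    have : (R₀ / r) ^ (s : ℝ) ≤ (R / r) ^ (s : ℝ) := by gcongr
    gcongr
    linarith
  · refine ⟨htfin.toFinset, (inter_subset_left.trans ht').trans ?_, ?_⟩
    · exact iUnion₂_mono fun y _ => Metric.closedBall_subset_closedBall hrR0
    · rw [← hM]
      nlinarith [mul_nonneg hM0 (sub_nonneg.2 hN1),
        mul_nonneg (mul_nonneg (by linarith : 0 ≤ M + 1) hN0.le) (sub_nonneg.2 hRr)]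

/-- Since `C` does not depend on `ρ`, one can choose `ρ` with `C * ρ ^ ε < 1`. Then `C / ρ ≤ ρ ^
(-(1 + ε))`, and the single ratio `ρ` makes `1 + ε` an exponent. -/
theorem assouadDim_le_one_of_linear_cover {F : Set X} (hF : TotallyBounded F) {C : ℝ}
    (h : ∀ ρ, 0 < ρ → ρ < 1 → ∃ R₀ > 0, ∀ R, 0 < R → R ≤ R₀ → ∀ x ∈ F,
      ∃ T : Finset X, (T : Set X) ⊆ F ∧
        F ∩ Metric.closedBall x R ⊆ ⋃ y ∈ T, Metric.closedBall y (ρ * R) ∧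
        (T.card : ℝ) ≤ C / ρ) :
    assouadDim F ≤ 1 := by
  refine ENNReal.le_of_forall_pos_le_add fun ε hε _ => ?_
  have hexp : IsAssouadExponent F (1 + ε) := by
    have hlim : Tendsto (fun ρ : ℝ => C * ρ ^ (ε : ℝ)) (𝓝[>] 0) (𝓝 (C * 0)) := by
      refine Tendsto.const_mul _ ?_
      have := (Real.continuousAt_rpow_const 0 (ε : ℝ) (Or.inr hε.le)).tendsto
      rw [Real.zero_rpow (by exact_mod_cast hε.ne')] at this
      exact this.mono_left nhdsWithin_le_nhds
    rw [mul_zero] at hlim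
    obtain ⟨ρ, hρC, hρ0, hρ1⟩ := ((hlim.eventually (gt_mem_nhds one_pos)).and
      (Ioo_mem_nhdsGT one_pos)).exists
    obtain ⟨R₀, hR₀, H⟩ := h ρ hρ0 hρ1
    refine isAssouadExponent_of_single_ratio hF hρ0 hρ1 hR₀ fun R hR hR' x hx => ?_
    obtain ⟨T, h1, h2, h3⟩ := H R hR hR' x hx
    refine ⟨T, h1, h2, h3.trans ?_⟩
    have hpos : 0 < ρ ^ (ε : ℝ) := Real.rpow_pos_of_pos hρ0 _
    rw [NNReal.coe_add, NNReal.coe_one, Real.rpow_add hρ0, Real.rpow_one, mul_inv, div_eq_inv_mul]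
    gcongr
    rw [← one_div, le_div_iff₀ hpos]
    exact hρC.le
  calc assouadDim F ≤ ((1 + ε : ℝ≥0) : ℝ≥0∞) := iInf₂_le _ hexp
    _ = 1 + ε := by push_cast; rfl

/-- One large ball contains `F`. Covering it at radii `R / (n + 2)` keeps the `s`-dimensional sums
below `C * (2R) ^ s`, so the Hausdorff measure is finite. -/
theorem dimH_le_of_isAssouadExponent {F : Set X} (hF : Bornology.IsBounded F) {s : ℝ≥0}
    (h : IsAssouadExponent F s) : dimH F ≤ s := by
  borelize X
  rcases F.eq_empty_or_nonempty with rfl | ⟨x, hx⟩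
  · simp
  obtain ⟨C, hC⟩ := h
  obtain ⟨R, hR0, hR⟩ := hF.subset_closedBall_lt 0 x
  -- The shift by 2 makes the radius strictly smaller than `R` already at `n = 0`.
  have hr : ∀ n : ℕ, 0 < R / (n + 2) := fun n => by positivity
  have hrR : ∀ n : ℕ, R / (n + 2) < R := fun n => by
    rw [div_lt_iff₀ (by positivity)]; nlinarith [(Nat.cast_nonneg n : (0 : ℝ) ≤ n)]
  choose T hT hTc using fun n : ℕ => hC x hx (R / (n + 2)) R (hr n) (hrR n)
  refine dimH_le_of_hausdorffMeasure_ne_top ?_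
  have key := Measure.hausdorffMeasure_le_liminf_sum (s : ℝ) F (l := atTop)
    (fun n : ℕ => ENNReal.ofReal (2 * (R / (n + 2)))) ?_
    (fun n (i : T n) => Metric.closedBall (i : X) (R / (n + 2))) ?_ ?_
  · refine ne_top_of_le_ne_top (ENNReal.ofReal_ne_top (r := C * (2 * R) ^ (s : ℝ))) (key.trans ?_)
    refine (liminf_le_liminf (v := fun _ => ENNReal.ofReal (C * (2 * R) ^ (s : ℝ)))
      (Eventually.of_forall fun n => ?_)).trans (by simp)
    calc ∑ i : T n, Metric.ediam (Metric.closedBall (i : X) (R / (n + 2))) ^ (s : ℝ)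
        ≤ ∑ i : T n, ENNReal.ofReal (2 * (R / (n + 2))) ^ (s : ℝ) := by
          gcongr
          exact Metric.ediam_le_of_forall_dist_le fun a ha b hb => by
            linarith [dist_triangle_right a b ‹T n›, Metric.mem_closedBall.1 ha,
              Metric.mem_closedBall.1 hb]
      _ = ENNReal.ofReal ((T n).card * (2 * (R / (n + 2))) ^ (s : ℝ)) := by
          rw [Finset.sum_const, nsmul_eq_mul,
            ENNReal.ofReal_rpow_of_nonneg (by positivity) s.coe_nonneg,
            ENNReal.ofReal_mul (p := ((T n).card : ℝ)) (by positivity)]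
          simp
      _ ≤ ENNReal.ofReal (C * (2 * R) ^ (s : ℝ)) := by
          apply ENNReal.ofReal_le_ofReal
          calc ((T n).card : ℝ) * (2 * (R / (n + 2))) ^ (s : ℝ)
              ≤ (C * (R / (R / (n + 2))) ^ (s : ℝ)) * (2 * (R / (n + 2))) ^ (s : ℝ) := by
                gcongr
                exact hTc n
            _ = C * (2 * R) ^ (s : ℝ) := by
                rw [mul_assoc, ← Real.mul_rpow (by positivity) (by positivity)]
                congr 2
                field_simp
  · rw [← ENNReal.ofReal_zero]
    refine ENNReal.tendsto_ofReal ?_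
    have h1 : Tendsto (fun n : ℕ => R / ((n : ℝ) + 2)) atTop (𝓝 0) :=
      tendsto_const_nhds.div_atTop
        (tendsto_atTop_add_const_right _ _ tendsto_natCast_atTop_atTop)
    simpa using h1.const_mul 2
  · refine Eventually.of_forall fun n i => ?_
    exact Metric.ediam_le_of_forall_dist_le fun a ha b hb => by
      linarith [dist_triangle_right a b i, Metric.mem_closedBall.1 ha, Metric.mem_closedBall.1 hb]
  · refine Eventually.of_forall fun n y hy => ?_
    have := hT n ⟨hy, hR hy⟩
    simp only [mem_iUnion] at this ⊢
    obtain ⟨z, hz, hyz⟩ := this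
    exact ⟨⟨z, hz⟩, hyz⟩

theorem dimH_le_assouadDim {F : Set X} (hF : Bornology.IsBounded F) : dimH F ≤ assouadDim F :=
  le_iInf₂ fun _ h => dimH_le_of_isAssouadExponent hF h

end Coverings

/-! ### Planar matrices contracting a cone -/

/-- The matrix `A` maps the double cone `|y| ≤ σ |x|` into the double cone `|y| ≤ σ' |x|`. -/
def MapsCone (σ σ' : ℝ) (A : Matrix (Fin 2) (Fin 2) ℝ) : Prop :=
  ∀ x y : ℝ, |y| ≤ σ * |x| → |A 1 0 * x + A 1 1 * y| ≤ σ' * |A 0 0 * x + A 0 1 * y|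

/-- The action of a matrix on the slopes of lines. -/
noncomputable def slopeMap (A : Matrix (Fin 2) (Fin 2) ℝ) (z : ℝ) : ℝ :=
  (A 1 0 + A 1 1 * z) / (A 0 0 + A 0 1 * z)

theorem MapsCone.mul {σ₁ σ₂ σ₃ : ℝ} {A B : Matrix (Fin 2) (Fin 2) ℝ} (hA : MapsCone σ₂ σ₃ A)
    (hB : MapsCone σ₁ σ₂ B) : MapsCone σ₁ σ₃ (A * B) := by
  intro x y h
  convert! hA _ _ (hB x y h) using 2
  · simp only [Matrix.mul_apply, Fin.sum_univ_two]; ring_nf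
  · simp only [Matrix.mul_apply, Fin.sum_univ_two]; ring_nf

theorem MapsCone.mono {σ σ' ρ ρ' : ℝ} {A : Matrix (Fin 2) (Fin 2) ℝ} (hA : MapsCone σ σ' A)
    (h : ρ ≤ σ) (h' : σ' ≤ ρ') : MapsCone ρ ρ' A := fun x y hxy =>
  (hA x y (hxy.trans (by gcongr))).trans (by gcongr)

theorem mapsCone_one (σ : ℝ) : MapsCone σ σ 1 := by
  intro x y h
  simpa using h

theorem slopeMap_one (z : ℝ) : slopeMap 1 z = z := by simp [slopeMap]

theorem slopeMap_mul (A B : Matrix (Fin 2) (Fin 2) ℝ) {z : ℝ} (hz : B 0 0 + B 0 1 * z ≠ 0) :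
    slopeMap (A * B) z = slopeMap A (slopeMap B z) := by
  unfold slopeMap
  rw [← mul_div_mul_right (A 1 0 + _) _ hz]
  congr 1
  · rw [add_mul, mul_assoc (A 1 1), div_mul_cancel₀ _ hz]
    simp only [Matrix.mul_apply, Fin.sum_univ_two]; ring
  · rw [add_mul, mul_assoc (A 0 1), div_mul_cancel₀ _ hz]
    simp only [Matrix.mul_apply, Fin.sum_univ_two]; ring

theorem slopeMap_sub (A : Matrix (Fin 2) (Fin 2) ℝ) {z z' : ℝ} (hz : A 0 0 + A 0 1 * z ≠ 0)
    (hz' : A 0 0 + A 0 1 * z' ≠ 0) :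
    slopeMap A z - slopeMap A z'
      = A.det * (z - z') / ((A 0 0 + A 0 1 * z) * (A 0 0 + A 0 1 * z')) := by
  unfold slopeMap
  rw [div_sub_div _ _ hz hz', Matrix.det_fin_two]
  ring

theorem MapsCone.abs_slopeMap_le {σ σ' : ℝ} {A : Matrix (Fin 2) (Fin 2) ℝ} (hA : MapsCone σ σ' A)
    {z : ℝ} (hz : |z| ≤ σ) (h : A 0 0 + A 0 1 * z ≠ 0) : |slopeMap A z| ≤ σ' := by
  have := hA 1 z (by simpa using hz)
  rw [mul_one, mul_one] at this
  rw [slopeMap, abs_div, div_le_iff₀ (abs_pos.2 h)]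
  exact this

/-- Finitely many invertible matrices which, together with their transposes, contract a cone of
angle at most `π / 4`, and which map it to pairwise disjoint cones. -/
structure ConeSystem (κ : ℕ) where
  /-- the matrices -/
  mat : Fin κ → Matrix (Fin 2) (Fin 2) ℝ
  /-- the slope of the cone -/
  τ : ℝ
  /-- the slope of a cone containing the images -/
  τ₁ : ℝ
  τ₁_pos : 0 < τ₁
  τ₁_lt : τ₁ < τ
  τ_le_one : τ ≤ 1
  det_ne_zero : ∀ i, (mat i).det ≠ 0
  mapsCone : ∀ i, MapsCone τ τ₁ (mat i)
  mapsCone_transpose : ∀ i, MapsCone τ τ₁ (mat i).transpose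
  disjoint : ∀ i j, i ≠ j → ∀ z z', |z| ≤ τ → |z'| ≤ τ →
    slopeMap (mat i) z ≠ slopeMap (mat j) z'

theorem prefixWord_succ {κ : ℕ} (i : ℕ → Fin κ) (n : ℕ) :
    prefixWord i (n + 1) = prefixWord i n ++ [i n] := by
  unfold prefixWord
  rw [List.ofFn_succ']
  simp

/-! ### Matrix products along words and the intervals of slopes they produce. -/

namespace ConeSystem

variable {κ : ℕ} (C : ConeSystem κ)

/-- The product of the matrices along a finite word. -/
noncomputable def word (w : List (Fin κ)) : Matrix (Fin 2) (Fin 2) ℝ := (w.map C.mat).prod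

@[simp] theorem word_nil : C.word [] = 1 := rfl

theorem word_cons (i : Fin κ) (w : List (Fin κ)) : C.word (i :: w) = C.mat i * C.word w := by
  simp [word]

theorem word_append (v w : List (Fin κ)) : C.word (v ++ w) = C.word v * C.word w := by
  simp [word]

@[simp] theorem word_singleton (i : Fin κ) : C.word [i] = C.mat i := by simp [word]

theorem τ_pos : 0 < C.τ := C.τ₁_pos.trans C.τ₁_lt

theorem τ₁_lt_one : C.τ₁ < 1 := C.τ₁_lt.trans_le C.τ_le_one

/-- The contraction ratio of the slopes. -/
noncomputable def θ : ℝ := C.τ₁ / C.τ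

theorem θ_pos : 0 < C.θ := div_pos C.τ₁_pos C.τ_pos

theorem θ_lt_one : C.θ < 1 := (div_lt_one C.τ_pos).2 C.τ₁_lt

theorem det_word_ne_zero (w : List (Fin κ)) : (C.word w).det ≠ 0 := by
  induction w with
  | nil => simp
  | cons i w ih => rw [word_cons, Matrix.det_mul]; exact mul_ne_zero (C.det_ne_zero i) ih

theorem mapsCone_word {σ : ℝ} (h1 : C.τ₁ ≤ σ) (h2 : σ ≤ C.τ) (w : List (Fin κ)) :
    MapsCone σ σ (C.word w) := by
  induction w with
  | nil => exact mapsCone_one σ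
  | cons i w ih => rw [word_cons]; exact ((C.mapsCone i).mono h2 h1).mul ih

theorem mapsCone_word_transpose (w : List (Fin κ)) :
    MapsCone C.τ₁ C.τ₁ (C.word w).transpose := by
  induction w with
  | nil => simpa using mapsCone_one C.τ₁
  | cons i w ih =>
    rw [word_cons, Matrix.transpose_mul]
    exact ih.mul ((C.mapsCone_transpose i).mono C.τ₁_lt.le le_rfl)

theorem abs_word_one_zero_le (w : List (Fin κ)) : |C.word w 1 0| ≤ C.τ₁ * |C.word w 0 0| := by
  simpa using C.mapsCone_word le_rfl C.τ₁_lt.le w 1 0 (by simpa using C.τ₁_pos.le)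

theorem abs_word_zero_one_le (w : List (Fin κ)) : |C.word w 0 1| ≤ C.τ₁ * |C.word w 0 0| := by
  simpa using C.mapsCone_word_transpose w 1 0 (by simpa using C.τ₁_pos.le)

/-- The image of the axis lies in the cone, so a vanishing upper left entry would annihilate the
whole first column. -/
theorem word_zero_zero_ne_zero (w : List (Fin κ)) : C.word w 0 0 ≠ 0 := by
  intro h
  have h1 := C.abs_word_one_zero_le w
  rw [h, abs_zero, mul_zero] at h1
  have h2 : C.word w 1 0 = 0 := abs_nonpos_iff.1 h1
  exact C.det_word_ne_zero w (by rw [Matrix.det_fin_two, h, h2]; ring)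

theorem abs_mul_le_of_abs_le (w : List (Fin κ)) {z : ℝ} (hz : |z| ≤ C.τ) :
    |C.word w 0 1 * z| ≤ C.τ₁ * |C.word w 0 0| := by
  rw [abs_mul]
  calc |C.word w 0 1| * |z| ≤ (C.τ₁ * |C.word w 0 0|) * 1 :=
        mul_le_mul (C.abs_word_zero_one_le w) (hz.trans C.τ_le_one) (abs_nonneg _)
          (mul_nonneg C.τ₁_pos.le (abs_nonneg _))
    _ = _ := mul_one _

/-- This is where `τ ≤ 1` and the transposed cone condition enter: the second summand is at most `τ₁
< 1` times the first, so the Möbius map has no pole on the cone. -/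
theorem denom_mul_pos (w : List (Fin κ)) {z : ℝ} (hz : |z| ≤ C.τ) :
    0 < (C.word w 0 0 + C.word w 0 1 * z) * C.word w 0 0 := by
  have h1 := C.abs_mul_le_of_abs_le w hz
  have h2 : 0 < |C.word w 0 0| := abs_pos.2 (C.word_zero_zero_ne_zero w)
  have h3 : |C.word w 0 1 * z * C.word w 0 0| ≤ C.τ₁ * (|C.word w 0 0| * |C.word w 0 0|) := by
    rw [abs_mul, ← mul_assoc]; gcongr
  have h4 := abs_mul_abs_self (C.word w 0 0)
  have h5 := neg_abs_le (C.word w 0 1 * z * C.word w 0 0)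
  have h6 := C.τ₁_lt_one
  nlinarith [mul_pos h2 h2]

theorem denom_ne_zero (w : List (Fin κ)) {z : ℝ} (hz : |z| ≤ C.τ) :
    C.word w 0 0 + C.word w 0 1 * z ≠ 0 :=
  left_ne_zero_of_mul (C.denom_mul_pos w hz).ne'

theorem denom_mul_denom_pos (w : List (Fin κ)) {z z' : ℝ} (hz : |z| ≤ C.τ) (hz' : |z'| ≤ C.τ) :
    0 < (C.word w 0 0 + C.word w 0 1 * z) * (C.word w 0 0 + C.word w 0 1 * z') := by
  have h := mul_pos (C.denom_mul_pos w hz) (C.denom_mul_pos w hz')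
  have h2 : 0 < C.word w 0 0 * C.word w 0 0 := mul_self_pos.2 (C.word_zero_zero_ne_zero w)
  refine pos_of_mul_pos_left (b := C.word w 0 0 * C.word w 0 0) ?_ h2.le
  linarith

/-- The slopes of the images of the cone under the word `w`. -/
noncomputable def slopes (w : List (Fin κ)) : ℝ → ℝ := slopeMap (C.word w)

theorem slopes_append (v w : List (Fin κ)) {z : ℝ} (hz : |z| ≤ C.τ) :
    C.slopes (v ++ w) z = C.slopes v (C.slopes w z) := by
  rw [slopes, word_append, slopeMap_mul _ _ (C.denom_ne_zero w hz)]; rfl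

theorem abs_slopes_le (w : List (Fin κ)) {σ z : ℝ} (h1 : C.τ₁ ≤ σ) (h2 : σ ≤ C.τ) (hz : |z| ≤ σ) :
    |C.slopes w z| ≤ σ :=
  (C.mapsCone_word h1 h2 w).abs_slopeMap_le hz (C.denom_ne_zero w (hz.trans h2))

theorem abs_slopes_singleton_le (i : Fin κ) {z : ℝ} (hz : |z| ≤ C.τ) :
    |C.slopes [i] z| ≤ C.τ₁ := by
  refine MapsCone.abs_slopeMap_le ?_ hz (C.denom_ne_zero [i] hz)
  rw [word_singleton]
  exact C.mapsCone i

theorem slopes_sub (w : List (Fin κ)) {z z' : ℝ} (hz : |z| ≤ C.τ) (hz' : |z'| ≤ C.τ) :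
    C.slopes w z - C.slopes w z' = (C.word w).det * (z - z') /
      ((C.word w 0 0 + C.word w 0 1 * z) * (C.word w 0 0 + C.word w 0 1 * z')) :=
  slopeMap_sub _ (C.denom_ne_zero w hz) (C.denom_ne_zero w hz')

theorem injOn_slopes (w : List (Fin κ)) : InjOn (C.slopes w) (Icc (-C.τ) C.τ) := by
  intro z hz z' hz' h
  have h1 := C.slopes_sub w (abs_le.2 hz) (abs_le.2 hz')
  rw [h, sub_self, eq_comm, div_eq_zero_iff] at h1
  rcases h1 with h1 | h1
  · exact sub_eq_zero.1 ((mul_eq_zero.1 h1).resolve_left (C.det_word_ne_zero w))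
  · exact absurd h1 (C.denom_mul_denom_pos w (abs_le.2 hz) (abs_le.2 hz')).ne'

theorem continuousOn_slopes (w : List (Fin κ)) : ContinuousOn (C.slopes w) (Icc (-C.τ) C.τ) := by
  refine ContinuousOn.div (by fun_prop) (by fun_prop) fun z hz => ?_
  exact C.denom_ne_zero w (abs_le.2 hz)

theorem slopes_image_subset_uIcc (w : List (Fin κ)) {σ : ℝ} (hσ : 0 ≤ σ) (hστ : σ ≤ C.τ) :
    C.slopes w '' Icc (-σ) σ ⊆ uIcc (C.slopes w (-σ)) (C.slopes w σ) := by
  have hsub : Icc (-σ) σ ⊆ Icc (-C.τ) C.τ := Icc_subset_Icc (by linarith) hστ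
  have hl : -σ ∈ Icc (-σ) σ := ⟨le_rfl, by linarith⟩
  have hr : σ ∈ Icc (-σ) σ := ⟨by linarith, le_rfl⟩
  rcases lt_or_gt_of_ne (C.det_word_ne_zero w) with hd | hd
  · have : AntitoneOn (C.slopes w) (Icc (-σ) σ) := by
      intro z hz z' hz' hzz
      have h1 := C.slopes_sub w (abs_le.2 (hsub hz)) (abs_le.2 (hsub hz'))
      have h2 := C.denom_mul_denom_pos w (abs_le.2 (hsub hz)) (abs_le.2 (hsub hz'))
      have : 0 ≤ C.slopes w z - C.slopes w z' := by
        rw [h1]; exact div_nonneg (mul_nonneg_of_nonpos_of_nonpos hd.le (by linarith)) h2.le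
      linarith
    rintro _ ⟨z, hz, rfl⟩
    rw [uIcc_comm]
    exact Icc_subset_uIcc ⟨this hz hr hz.2, this hl hz hz.1⟩
  · have : MonotoneOn (C.slopes w) (Icc (-σ) σ) := by
      intro z hz z' hz' hzz
      have h1 := C.slopes_sub w (abs_le.2 (hsub hz')) (abs_le.2 (hsub hz))
      have h2 := C.denom_mul_denom_pos w (abs_le.2 (hsub hz')) (abs_le.2 (hsub hz))
      have : 0 ≤ C.slopes w z' - C.slopes w z := by
        rw [h1]; exact div_nonneg (mul_nonneg hd.le (by linarith)) h2.le
      linarith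
    rintro _ ⟨z, hz, rfl⟩
    exact Icc_subset_uIcc ⟨this hl hz hz.1, this hz hr hz.2⟩

/-- The length of the interval of slopes of the image of the cone under the word `w`. -/
noncomputable def len (w : List (Fin κ)) : ℝ := |C.slopes w C.τ - C.slopes w (-C.τ)|

theorem len_nonneg (w : List (Fin κ)) : 0 ≤ C.len w := abs_nonneg _

theorem abs_slopes_sub (w : List (Fin κ)) {σ : ℝ} (hσ : 0 ≤ σ) (hστ : σ ≤ C.τ) :
    |C.slopes w σ - C.slopes w (-σ)| = |(C.word w).det| * (2 * σ) /
      (C.word w 0 0 ^ 2 - C.word w 0 1 ^ 2 * σ ^ 2) ∧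
      0 < C.word w 0 0 ^ 2 - C.word w 0 1 ^ 2 * σ ^ 2 := by
  have h1 : |σ| ≤ C.τ := by rwa [abs_of_nonneg hσ]
  have h2 : |-σ| ≤ C.τ := by rwa [abs_neg]
  have h3 := C.denom_mul_denom_pos w h1 h2
  have h4 : (C.word w 0 0 + C.word w 0 1 * σ) * (C.word w 0 0 + C.word w 0 1 * -σ)
      = C.word w 0 0 ^ 2 - C.word w 0 1 ^ 2 * σ ^ 2 := by ring
  rw [h4] at h3
  refine ⟨?_, h3⟩
  rw [C.slopes_sub w h1 h2, h4, abs_div, abs_of_pos h3, abs_mul, abs_of_nonneg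
    (by linarith : 0 ≤ σ - -σ)]
  ring

/-- In the formula of `abs_slopes_sub`, passing from `τ` to `τ₁` scales the numerator by `θ` and
does not decrease the denominator. -/
theorem abs_slopes_sub_le_theta_mul_len (w : List (Fin κ)) :
    |C.slopes w C.τ₁ - C.slopes w (-C.τ₁)| ≤ C.θ * C.len w := by
  obtain ⟨h1, h2⟩ := C.abs_slopes_sub w C.τ₁_pos.le C.τ₁_lt.le
  obtain ⟨h3, h4⟩ := C.abs_slopes_sub w C.τ_pos.le le_rfl
  have hτ := C.τ_pos
  rw [len, h1, h3, θ]
  have : C.τ₁ / C.τ * (|(C.word w).det| * (2 * C.τ) /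
      (C.word w 0 0 ^ 2 - C.word w 0 1 ^ 2 * C.τ ^ 2))
      = |(C.word w).det| * (2 * C.τ₁) / (C.word w 0 0 ^ 2 - C.word w 0 1 ^ 2 * C.τ ^ 2) := by
    field_simp
  rw [this]
  have h5 := C.τ₁_lt
  have h6 := C.τ₁_pos
  gcongr

theorem abs_det_le_of_len (w : List (Fin κ)) :
    |(C.word w).det| * (2 * C.τ) ≤ C.len w * C.word w 0 0 ^ 2 := by
  obtain ⟨h3, h4⟩ := C.abs_slopes_sub w C.τ_pos.le le_rfl
  rw [len, h3, div_mul_eq_mul_div, le_div_iff₀ h4]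
  gcongr
  · have := C.τ_pos; positivity
  · have : 0 ≤ C.word w 0 1 ^ 2 * C.τ ^ 2 := by positivity
    linarith

/-- The slope intervals of the children `w ++ [i]` are disjoint, by separation and injectivity, and
all lie in the image of `[-τ₁, τ₁]` under `w`. Additivity of length does the rest. -/
theorem sum_len_le (w : List (Fin κ)) :
    ∑ i, ENNReal.ofReal (C.len (w ++ [i])) ≤ ENNReal.ofReal (C.θ * C.len w) := by
  set J := Icc (-C.τ) C.τ with hJ
  have hmem : ∀ {z : ℝ}, z ∈ J → |z| ≤ C.τ := fun h => abs_le.2 h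
  have himg : ∀ i, C.slopes (w ++ [i]) '' J = C.slopes w '' (C.slopes [i] '' J) := fun i => by
    rw [image_image]
    exact image_congr fun z hz => C.slopes_append w [i] (hmem hz)
  have hJ1 : ∀ i, C.slopes [i] '' J ⊆ Icc (-C.τ₁) C.τ₁ := by
    rintro i _ ⟨z, hz, rfl⟩
    exact abs_le.1 (C.abs_slopes_singleton_le i (hmem hz))
  have hJJ : Icc (-C.τ₁) C.τ₁ ⊆ J := Icc_subset_Icc (by linarith [C.τ₁_lt]) C.τ₁_lt.le
  calc ∑ i, ENNReal.ofReal (C.len (w ++ [i]))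
      ≤ ∑ i, volume (C.slopes (w ++ [i]) '' J) := by
        gcongr with i
        have h1 := intermediate_value_uIcc (a := -C.τ) (b := C.τ) (f := C.slopes (w ++ [i]))
          (by rw [uIcc_of_le (by linarith [C.τ_pos])]; exact C.continuousOn_slopes _)
        rw [uIcc_of_le (by linarith [C.τ_pos] : -C.τ ≤ C.τ)] at h1
        rw [len, ← Real.volume_interval]
        exact measure_mono h1
    _ = volume (⋃ i, C.slopes (w ++ [i]) '' J) := by
        rw [measure_iUnion, tsum_fintype]
        · intro i j hij
          rw [Function.onFun, himg, himg]
          refine Disjoint.image ?_ (C.injOn_slopes w) ((hJ1 i).trans hJJ) ((hJ1 j).trans hJJ)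
          rw [Set.disjoint_left]
          rintro _ ⟨z, hz, rfl⟩ ⟨z', hz', h⟩
          simp only [slopes, word_singleton] at h
          exact C.disjoint j i hij.symm z' z (hmem hz') (hmem hz) h
        · exact fun i => (isCompact_Icc.image_of_continuousOn
            (C.continuousOn_slopes _)).isClosed.measurableSet
    _ ≤ volume (uIcc (C.slopes w (-C.τ₁)) (C.slopes w C.τ₁)) := by
        refine measure_mono (iUnion_subset fun i => ?_)
        rw [himg]
        exact (image_mono (hJ1 i)).trans
          (C.slopes_image_subset_uIcc w C.τ₁_pos.le C.τ₁_lt.le)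
    _ ≤ ENNReal.ofReal (C.θ * C.len w) := by
        rw [Real.volume_interval]
        exact ENNReal.ofReal_le_ofReal (C.abs_slopes_sub_le_theta_mul_len w)

theorem len_append_singleton_le (w : List (Fin κ)) (i : Fin κ) :
    C.len (w ++ [i]) ≤ C.θ * C.len w := by
  have h := (Finset.single_le_sum (f := fun i => ENNReal.ofReal (C.len (w ++ [i])))
    (fun _ _ => zero_le) (Finset.mem_univ i)).trans (C.sum_len_le w)
  exact (ENNReal.ofReal_le_ofReal_iff (mul_nonneg C.θ_pos.le (C.len_nonneg w))).1 h

theorem len_nil : C.len [] = 2 * C.τ := by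
  rw [len, slopes, word_nil, slopeMap_one, slopeMap_one, sub_neg_eq_add, ← two_mul,
    abs_of_pos (by linarith [C.τ_pos])]

theorem len_le (w : List (Fin κ)) : C.len w ≤ C.θ ^ w.length * (2 * C.τ) := by
  induction w using List.reverseRecOn with
  | nil => simp [len_nil]
  | append_singleton w i ih =>
    refine (C.len_append_singleton_le w i).trans ?_
    rw [List.length_append, List.length_singleton, pow_succ', mul_assoc]
    exact mul_le_mul_of_nonneg_left ih C.θ_pos.le

/-- The slope interval has length about `|det| / p ^ 2`, `p` being the upper left entry, and it
shrinks like `θ ^ n`. This is the quantitative thinness of cylinders. -/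
theorem abs_det_word_le (w : List (Fin κ)) :
    |(C.word w).det| ≤ C.θ ^ w.length * C.word w 0 0 ^ 2 := by
  have h1 := C.abs_det_le_of_len w
  have h2 := mul_le_mul_of_nonneg_right (C.len_le w) (sq_nonneg (C.word w 0 0))
  have h3 := C.τ_pos
  nlinarith

/-- The slopes of the images of the cone under the words of length `n`. -/
def level : ℕ → Set ℝ
  | 0 => Icc (-C.τ) C.τ
  | n + 1 => ⋃ i, C.slopes [i] '' level n

theorem level_subset_Icc (n : ℕ) : C.level n ⊆ Icc (-C.τ) C.τ := by
  induction n with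
  | zero => exact subset_rfl
  | succ n ih =>
    refine iUnion_subset fun i => ?_
    rintro _ ⟨z, hz, rfl⟩
    exact abs_le.1 (C.abs_slopes_le [i] C.τ₁_lt.le le_rfl (abs_le.2 (ih hz)))

theorem abs_le_of_mem_level_one {z : ℝ} (hz : z ∈ C.level 1) : |z| ≤ C.τ₁ := by
  simp only [level, mem_iUnion] at hz
  obtain ⟨i, z, hz, rfl⟩ := hz
  exact C.abs_slopes_singleton_le i (abs_le.2 hz)

theorem isCompact_level (n : ℕ) : IsCompact (C.level n) := by
  induction n with
  | zero => exact isCompact_Icc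
  | succ n ih => exact isCompact_iUnion fun i =>
      ih.image_of_continuousOn ((C.continuousOn_slopes [i]).mono (C.level_subset_Icc n))

theorem antitone_level : Antitone C.level := by
  refine antitone_nat_of_succ_le fun n => ?_
  induction n with
  | zero => exact C.level_subset_Icc 1
  | succ n ih => exact iUnion_mono fun i => image_mono ih

theorem slopes_mem_level (w : List (Fin κ)) {z : ℝ} (hz : |z| ≤ C.τ) {n : ℕ} (hn : n ≤ w.length) :
    C.slopes w z ∈ C.level n := by
  refine C.antitone_level hn ?_
  clear hn
  induction w with
  | nil => rw [slopes, word_nil, slopeMap_one]; exact abs_le.1 hz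
  | cons i w ih =>
    have := C.slopes_append [i] w hz
    rw [List.singleton_append] at this
    rw [this]
    exact mem_iUnion.2 ⟨i, mem_image_of_mem _ ih⟩

theorem volume_slopes_image_level_le (n : ℕ) (w : List (Fin κ)) :
    volume (C.slopes w '' C.level n) ≤ ENNReal.ofReal (C.θ ^ n * C.len w) := by
  induction n generalizing w with
  | zero =>
    rw [pow_zero, one_mul, len, ← Real.volume_interval]
    exact measure_mono (C.slopes_image_subset_uIcc w C.τ_pos.le le_rfl)
  | succ n ih =>
    have : C.slopes w '' C.level (n + 1) = ⋃ i, C.slopes (w ++ [i]) '' C.level n := by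
      rw [level, image_iUnion]
      refine iUnion_congr fun i => ?_
      rw [image_image]
      exact image_congr fun z hz =>
        (C.slopes_append w [i] (abs_le.2 (C.level_subset_Icc n hz))).symm
    have hθ := C.θ_pos
    calc volume (C.slopes w '' C.level (n + 1))
        ≤ ∑ i, volume (C.slopes (w ++ [i]) '' C.level n) := by
          rw [this]; exact measure_iUnion_fintype_le _ _
      _ ≤ ∑ i, ENNReal.ofReal (C.θ ^ n) * ENNReal.ofReal (C.len (w ++ [i])) := by
          gcongr with i
          rw [← ENNReal.ofReal_mul (by positivity)]
          exact ih _
      _ = ENNReal.ofReal (C.θ ^ n) * ∑ i, ENNReal.ofReal (C.len (w ++ [i])) := by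
          rw [Finset.mul_sum]
      _ ≤ ENNReal.ofReal (C.θ ^ n) * ENNReal.ofReal (C.θ * C.len w) := by
          gcongr
          exact C.sum_len_le w
      _ = ENNReal.ofReal (C.θ ^ (n + 1) * C.len w) := by
          rw [← ENNReal.ofReal_mul (by positivity), ← mul_assoc, ← pow_succ]

/-- The slopes of the limit directions. -/
def limitSlopes : Set ℝ := ⋂ n, C.level n

/-- The total length of the intervals of level `n` is at most `θ ^ n * 2τ`. -/
theorem volume_limitSlopes : volume C.limitSlopes = 0 := by
  have h : ∀ n, volume C.limitSlopes ≤ ENNReal.ofReal (C.θ ^ n * (2 * C.τ)) := fun n => by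
    have h1 := C.volume_slopes_image_level_le n []
    have h2 : C.slopes [] = id := by
      funext z; rw [slopes, word_nil, slopeMap_one]; rfl
    rw [len_nil, h2, image_id] at h1
    exact (measure_mono (iInter_subset _ n)).trans h1
  refine le_antisymm (ge_of_tendsto' (x := atTop) ?_ h) zero_le
  rw [← ENNReal.ofReal_zero]
  refine ENNReal.tendsto_ofReal ?_
  simpa using (tendsto_pow_atTop_nhds_zero_of_lt_one C.θ_pos.le C.θ_lt_one).mul_const (2 * C.τ)

theorem isClosed_limitSlopes : IsClosed C.limitSlopes :=
  isClosed_iInter fun n => (C.isCompact_level n).isClosed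

theorem abs_le_of_mem_limitSlopes {z : ℝ} (hz : z ∈ C.limitSlopes) : |z| ≤ C.τ₁ :=
  C.abs_le_of_mem_level_one (mem_iInter.1 hz 1)

/-- Along an infinite word, the slopes converge to a limit slope. -/
theorem exists_tendsto_slopes (i : ℕ → Fin κ) :
    ∃ z ∈ C.limitSlopes, Tendsto (fun n => C.slopes (prefixWord i n) 0) atTop (𝓝 z) := by
  set J := Icc (-C.τ) C.τ with hJ
  have h0 : (0 : ℝ) ∈ J := ⟨by linarith [C.τ_pos], C.τ_pos.le⟩
  have hcomp : ∀ n, IsCompact (C.slopes (prefixWord i n) '' J) := fun n =>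
    isCompact_Icc.image_of_continuousOn (C.continuousOn_slopes _)
  obtain ⟨z, hz⟩ := IsCompact.nonempty_iInter_of_sequence_nonempty_isCompact_isClosed
    (fun n => C.slopes (prefixWord i n) '' J) (fun n => by
      rintro _ ⟨z, hz, rfl⟩
      rw [prefixWord_succ, C.slopes_append _ _ (abs_le.2 hz)]
      exact mem_image_of_mem _ (abs_le.1 (C.abs_slopes_le _ C.τ₁_lt.le le_rfl (abs_le.2 hz))))
    (fun n => ⟨_, mem_image_of_mem _ h0⟩) (hcomp 0) (fun n => (hcomp n).isClosed)
  rw [mem_iInter] at hz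
  have hlen : ∀ n, (prefixWord i n).length = n := fun n => by simp [prefixWord]
  refine ⟨z, mem_iInter.2 fun n => ?_, ?_⟩
  · obtain ⟨y, hy, rfl⟩ := hz n
    exact C.slopes_mem_level _ (abs_le.2 hy) (hlen n).ge
  · rw [tendsto_iff_dist_tendsto_zero]
    refine squeeze_zero (fun _ => dist_nonneg) (g := fun n => C.θ ^ n * (2 * C.τ)) (fun n => ?_) ?_
    · have h1 := C.slopes_image_subset_uIcc (prefixWord i n) C.τ_pos.le le_rfl
      have h2 := C.len_le (prefixWord i n)
      rw [hlen] at h2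
      refine le_trans ?_ h2
      rw [len, abs_sub_comm]
      exact Real.dist_le_of_mem_uIcc (h1 (mem_image_of_mem _ h0)) (h1 (hz n))
    · simpa using
        (tendsto_pow_atTop_nhds_zero_of_lt_one C.θ_pos.le C.θ_lt_one).mul_const (2 * C.τ)

end ConeSystem

/-! ### Coordinates -/

/-- The matrix of a linear map of the plane in an orthonormal basis. -/
noncomputable def coordMatrix (b : OrthonormalBasis (Fin 2) ℝ Plane) (A : Plane →L[ℝ] Plane) :
    Matrix (Fin 2) (Fin 2) ℝ :=
  Matrix.of fun i j => b.repr (A (b j)) i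

section Coordinates

variable (b : OrthonormalBasis (Fin 2) ℝ Plane)

theorem repr_clm_apply (A : Plane →L[ℝ] Plane) (v : Plane) (i : Fin 2) :
    b.repr (A v) i = coordMatrix b A i 0 * b.repr v 0 + coordMatrix b A i 1 * b.repr v 1 := by
  conv_lhs => rw [← b.sum_repr v]
  simp [Fin.sum_univ_two, coordMatrix, mul_comm]

theorem coordMatrix_comp (A B : Plane →L[ℝ] Plane) :
    coordMatrix b (A ∘L B) = coordMatrix b A * coordMatrix b B := by
  ext i j
  rw [Matrix.mul_apply, Fin.sum_univ_two]
  exact repr_clm_apply b A (B (b j)) i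

theorem coordMatrix_id : coordMatrix b (ContinuousLinearMap.id ℝ Plane) = 1 := by
  ext i j
  simp [coordMatrix, Matrix.one_apply]

theorem coordMatrix_adjoint (A : Plane →L[ℝ] Plane) :
    coordMatrix b A.adjoint = (coordMatrix b A).transpose := by
  ext i j
  simp only [coordMatrix, Matrix.of_apply, Matrix.transpose_apply, b.repr_apply_apply]
  rw [ContinuousLinearMap.adjoint_inner_right, real_inner_comm]

theorem det_coordMatrix_ne_zero (A : Plane ≃L[ℝ] Plane) :
    (coordMatrix b (A : Plane →L[ℝ] Plane)).det ≠ 0 := by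
  have h : coordMatrix b (A : Plane →L[ℝ] Plane) * coordMatrix b (A.symm : Plane →L[ℝ] Plane)
      = 1 := by
    rw [← coordMatrix_comp, A.coe_comp_coe_symm, coordMatrix_id]
  intro h0
  have := congrArg Matrix.det h
  rw [Matrix.det_mul, h0, zero_mul, Matrix.det_one] at this
  exact zero_ne_one this

theorem norm_sq_eq_repr (v : Plane) : ‖v‖ ^ 2 = b.repr v 0 ^ 2 + b.repr v 1 ^ 2 := by
  rw [← b.repr.norm_map v, EuclideanSpace.norm_sq_eq, Fin.sum_univ_two]
  simp

theorem inner_eq_repr (v w : Plane) :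
    inner ℝ v w = b.repr v 0 * b.repr w 0 + b.repr v 1 * b.repr w 1 := by
  rw [← b.repr.inner_map_map v w, PiLp.inner_apply, Fin.sum_univ_two]
  simp [mul_comm]

theorem eq_zero_iff_repr (v : Plane) : v = 0 ↔ b.repr v 0 = 0 ∧ b.repr v 1 = 0 := by
  constructor
  · rintro rfl; simp
  · rintro ⟨h0, h1⟩
    rw [← norm_eq_zero, ← sq_eq_zero_iff, norm_sq_eq_repr b, h0, h1]; simp

theorem ext_repr {v w : Plane} (h0 : b.repr v 0 = b.repr w 0) (h1 : b.repr v 1 = b.repr w 1) :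
    v = w := by
  rw [← sub_eq_zero, eq_zero_iff_repr b]
  simp [h0, h1]

theorem abs_repr_le_norm (v : Plane) (i : Fin 2) : |b.repr v i| ≤ ‖v‖ := by
  rw [← b.repr.norm_map v]
  exact PiLp.norm_apply_le (b.repr v) i

end Coordinates

/-! ### Angles and cones in coordinates. -/

theorem cos_vecLineAngle (u v : Plane) :
    Real.cos (vecLineAngle u v) = |Real.cos (InnerProductGeometry.angle u v)| := by
  have h0 := InnerProductGeometry.angle_nonneg u v
  have h1 := InnerProductGeometry.angle_le_pi u v
  unfold vecLineAngle
  rcases le_total (InnerProductGeometry.angle u v) (Real.pi / 2) with h | h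
  · rw [min_eq_left (by linarith), abs_of_nonneg]
    exact Real.cos_nonneg_of_neg_pi_div_two_le_of_le (by linarith) h
  · rw [min_eq_right (by linarith), Real.cos_pi_sub, abs_of_nonpos]
    exact Real.cos_nonpos_of_pi_div_two_le_of_le h (by linarith)

theorem vecLineAngle_nonneg (u v : Plane) : 0 ≤ vecLineAngle u v :=
  le_min (InnerProductGeometry.angle_nonneg u v)
    (sub_nonneg.2 (InnerProductGeometry.angle_le_pi u v))

theorem vecLineAngle_le_pi (u v : Plane) : vecLineAngle u v ≤ Real.pi :=
  (min_le_left _ _).trans (InnerProductGeometry.angle_le_pi u v)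

theorem abs_inner_eq_cos_vecLineAngle (u v : Plane) :
    |inner ℝ u v| = Real.cos (vecLineAngle u v) * (‖u‖ * ‖v‖) := by
  rw [cos_vecLineAngle, ← InnerProductGeometry.cos_angle_mul_norm_mul_norm, abs_mul,
    abs_of_nonneg (by positivity : 0 ≤ ‖u‖ * ‖v‖)]

/-- In an orthonormal basis whose first vector is the axis, a cone is given by a slope bound. -/
theorem mem_cone_iff_repr (b : OrthonormalBasis (Fin 2) ℝ Plane) {m : ℙ ℝ Plane}
    (hb : b 0 ≠ 0) (hm : m = Projectivization.mk ℝ (b 0) hb) {ω : ℝ} (h0 : 0 < ω)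
    (h1 : ω < Real.pi / 2) (v : Plane) :
    v ∈ cone m ω ↔ v ≠ 0 ∧ |b.repr v 1| ≤ Real.tan ω * |b.repr v 0| := by
  subst hm
  have hcos : 0 < Real.cos ω := Real.cos_pos_of_mem_Ioo ⟨by linarith, h1⟩
  have hsin : 0 < Real.sin ω := Real.sin_pos_of_pos_of_lt_pi h0 (by linarith)
  simp only [cone, mem_ofPred_eq, lineAngle_mk_mk]
  rw [exists_prop]
  refine and_congr_right fun hv => ?_
  have hi : |b.repr v 0| = Real.cos (vecLineAngle (b 0) v) * ‖v‖ := by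
    rw [b.repr_apply_apply, abs_inner_eq_cos_vecLineAngle, b.orthonormal.norm_eq_one, one_mul]
  have hv0 : 0 < ‖v‖ := norm_pos_iff.2 hv
  have step1 : vecLineAngle (b 0) v ≤ ω ↔ Real.cos ω * ‖v‖ ≤ |b.repr v 0| := by
    rw [hi, mul_le_mul_iff_left₀ hv0]
    exact (Real.strictAntiOn_cos.le_iff_ge ⟨h0.le, by linarith⟩
      ⟨vecLineAngle_nonneg _ _, vecLineAngle_le_pi _ _⟩).symm
  have hpyth := Real.sin_sq_add_cos_sq ω
  rw [step1, Real.tan_eq_sin_div_cos, div_mul_eq_mul_div, le_div_iff₀ hcos,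
    ← abs_of_pos (mul_pos hcos hv0), ← sq_le_sq, mul_pow, norm_sq_eq_repr b,
    ← abs_of_pos hcos, ← abs_mul, ← abs_of_pos hsin, ← abs_mul, ← sq_le_sq, mul_pow, mul_pow,
    sq_abs, show Real.sin ω ^ 2 = 1 - Real.cos ω ^ 2 by linarith]
  constructor <;> intro h <;> linarith

/-- Moving an interior point by `± ε / 2` along `b 1` keeps it in the cone, which leaves slack in
the slope bound. -/
theorem abs_repr_lt_of_mem_interior_cone (b : OrthonormalBasis (Fin 2) ℝ Plane) {m : ℙ ℝ Plane}
    (hb : b 0 ≠ 0) (hm : m = Projectivization.mk ℝ (b 0) hb) {ω : ℝ} (h0 : 0 < ω)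
    (h1 : ω < Real.pi / 2) {v : Plane} (hv : v ∈ interior (cone m ω)) :
    |b.repr v 1| < Real.tan ω * |b.repr v 0| := by
  have hcont : Continuous fun t : ℝ => v + t • b 1 := by fun_prop
  have hnear : ∀ᶠ t : ℝ in 𝓝 0, v + t • b 1 ∈ cone m ω := by
    have h : cone m ω ∈ 𝓝 ((fun t : ℝ => v + t • b 1) 0) := by
      simpa using mem_interior_iff_mem_nhds.1 hv
    exact hcont.continuousAt.eventually h
  obtain ⟨ε, hε, hball⟩ := Metric.eventually_nhds_iff.1 hnear
  have key : ∀ t : ℝ, |t| < ε → |b.repr v 1 + t| ≤ Real.tan ω * |b.repr v 0| := fun t ht => by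
    have := ((mem_cone_iff_repr b hb hm h0 h1 _).1 (hball (by simpa using ht))).2
    simpa [OrthonormalBasis.repr_self] using this
  have e1 := key (ε / 2) (by rw [abs_of_pos (by linarith)]; linarith)
  have e2 := key (-(ε / 2)) (by rw [abs_neg, abs_of_pos (by linarith)]; linarith)
  rw [abs_le] at e1 e2
  rw [abs_lt]
  constructor <;> linarith

/-! ### From cone separation to a cone system -/

/-- The matrix `A` maps the double cone `|y| ≤ σ |x|` into its interior. -/
def StrictlyMapsCone (σ : ℝ) (A : Matrix (Fin 2) (Fin 2) ℝ) : Prop :=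
  ∀ x y : ℝ, x ≠ 0 → |y| ≤ σ * |x| → |A 1 0 * x + A 1 1 * y| < σ * |A 0 0 * x + A 0 1 * y|

/-- A matrix maps the dual cone into its interior if its transpose does so with the cone. -/
theorem StrictlyMapsCone.dual {σ : ℝ} (hσ : 0 < σ) {A : Matrix (Fin 2) (Fin 2) ℝ}
    (hA : StrictlyMapsCone σ A.transpose) : StrictlyMapsCone σ⁻¹ A := by
  intro x y hx hxy
  simp only [StrictlyMapsCone, Matrix.transpose_apply] at hA
  -- The expression is `⟨Av, (1, z)⟩ = ⟨v, Aᵀ(1, z)⟩` with `v = (x, y)` in the dual cone and `Aᵀ(1,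
  -- z)` interior to the cone, so it cannot vanish.
  have hne : ∀ z, |z| ≤ σ → (A 0 0 * x + A 0 1 * y) + z * (A 1 0 * x + A 1 1 * y) ≠ 0 := by
    intro z hz h
    have h1 := hA 1 z one_ne_zero (by simpa using hz)
    rw [mul_one, mul_one] at h1
    have h2 : (A 0 0 + A 1 0 * z) * x = -((A 0 1 + A 1 1 * z) * y) := by linear_combination h
    have h3 := congrArg abs h2
    rw [abs_neg, abs_mul, abs_mul] at h3
    have hx' := abs_pos.2 hx
    have h5 : |y| * σ ≤ |x| := by
      rwa [inv_mul_eq_div, le_div_iff₀ hσ] at hxy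
    have h6 : 0 < |A 0 0 + A 1 0 * z| := by
      by_contra hcon
      have : |A 0 0 + A 1 0 * z| = 0 := le_antisymm (not_lt.1 hcon) (abs_nonneg _)
      rw [this, mul_zero] at h1
      exact absurd h1 (not_lt.2 (abs_nonneg _))
    rcases eq_or_lt_of_le (abs_nonneg y) with hy | hy
    · rw [← hy, mul_zero] at h3
      exact absurd h3 (mul_pos h6 hx').ne'
    · have := mul_lt_mul_of_pos_right h1 hy
      nlinarith
  rw [inv_mul_eq_div, lt_div_iff₀ hσ]
  by_contra hcon
  rw [not_lt] at hcon
  rcases eq_or_ne (A 1 0 * x + A 1 1 * y) 0 with h0 | h0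
  · rw [h0, abs_zero, zero_mul] at hcon
    refine hne 0 (by simpa using hσ.le) ?_
    rw [zero_mul, add_zero]
    exact abs_nonpos_iff.1 hcon
  -- If `Av` were not interior to the dual cone, some `(1, z)` with `|z| ≤ σ` would be orthogonal to
  -- it.
  · refine hne (-(A 0 0 * x + A 0 1 * y) / (A 1 0 * x + A 1 1 * y)) ?_ ?_
    · rw [abs_div, abs_neg, div_le_iff₀ (abs_pos.2 h0)]
      linarith
    · rw [div_mul_cancel₀ _ h0, add_neg_cancel]

/-- The slope of the image is continuous on a compact interval, so its largest modulus is attained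
and is still less than `σ`. -/
theorem StrictlyMapsCone.exists_mapsCone {σ : ℝ} (hσ : 0 < σ) {A : Matrix (Fin 2) (Fin 2) ℝ}
    (hA : StrictlyMapsCone σ A) : ∃ t < σ, MapsCone σ t A := by
  have hA1 : ∀ z ∈ Icc (-σ) σ, |A 1 0 + A 1 1 * z| < σ * |A 0 0 + A 0 1 * z| := fun z hz => by
    simpa using hA 1 z one_ne_zero (by simpa using abs_le.2 hz)
  have hpos : ∀ z ∈ Icc (-σ) σ, 0 < |A 0 0 + A 0 1 * z| := fun z hz => by
    have := (abs_nonneg _).trans_lt (hA1 z hz)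
    exact pos_of_mul_pos_right this hσ.le
  have hcont : ContinuousOn (fun z => |slopeMap A z|) (Icc (-σ) σ) := by
    refine ContinuousOn.abs (ContinuousOn.div (by fun_prop) (by fun_prop) fun z hz => ?_)
    exact abs_pos.1 (hpos z hz)
  obtain ⟨z₀, hz₀, hmax⟩ := isCompact_Icc.exists_isMaxOn ⟨0, by simp [hσ.le]⟩ hcont
  refine ⟨|slopeMap A z₀|, ?_, ?_⟩
  · rw [slopeMap, abs_div, div_lt_iff₀ (hpos z₀ hz₀)]
    exact hA1 z₀ hz₀
  · intro x y hxy
    rcases eq_or_ne x 0 with rfl | hx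
    · rw [abs_zero, mul_zero] at hxy
      simp [abs_nonpos_iff.1 hxy]
    · have hz : y / x ∈ Icc (-σ) σ := by
        rw [mem_Icc, ← abs_le, abs_div, div_le_iff₀ (abs_pos.2 hx)]
        exact hxy
      have h1 : |slopeMap A (y / x)| ≤ |slopeMap A z₀| := hmax hz
      rw [slopeMap, abs_div, div_le_iff₀ (hpos _ hz)] at h1
      have e1 : A 1 0 * x + A 1 1 * y = (A 1 0 + A 1 1 * (y / x)) * x := by field_simp
      have e2 : A 0 0 * x + A 0 1 * y = (A 0 0 + A 0 1 * (y / x)) * x := by field_simp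
      rw [e1, e2, abs_mul, abs_mul, ← mul_assoc]
      gcongr

/-- Strong cone separation provides a cone system in suitable orthonormal coordinates. -/
theorem AffineIFS.StrongConeSeparation.exists_coneSystem {κ : ℕ} {S : AffineIFS κ}
    (h : S.StrongConeSeparation) :
    ∃ (b : OrthonormalBasis (Fin 2) ℝ Plane) (C : ConeSystem κ),
      ∀ i, C.mat i = coordMatrix b (S.lin i : Plane →L[ℝ] Plane) := by
  obtain ⟨m, ω, hω0, hω1, hA, hAT, hdisj⟩ := h
  obtain ⟨b, hbm⟩ : ∃ b : OrthonormalBasis (Fin 2) ℝ Plane, b 0 = ‖m.rep‖⁻¹ • m.rep := by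
    have horth : Orthonormal ℝ (({0} : Set (Fin 2)).domRestrict
        fun _ : Fin 2 => ‖m.rep‖⁻¹ • m.rep) := by
      constructor
      · intro i
        change ‖‖m.rep‖⁻¹ • m.rep‖ = 1
        rw [norm_smul, norm_inv, norm_norm, inv_mul_cancel₀ (norm_ne_zero_iff.2 m.rep_nonzero)]
      · intro i j hij
        exact absurd (Subsingleton.elim i j) hij
    obtain ⟨b, hb⟩ := horth.exists_orthonormalBasis_extension_of_card_eq (by simp)
    exact ⟨b, hb 0 rfl⟩
  have hb0 : b 0 ≠ 0 := b.orthonormal.ne_zero 0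
  have hm : m = Projectivization.mk ℝ (b 0) hb0 := by
    conv_lhs => rw [← m.mk_rep]
    rw [Projectivization.mk_eq_mk_iff']
    refine ⟨‖m.rep‖, ?_⟩
    rw [hbm, smul_smul, mul_inv_cancel₀ (norm_ne_zero_iff.2 m.rep_nonzero), one_smul]
  set σ := Real.tan ω with hσ
  have hσ0 : 0 < σ := Real.tan_pos_of_pos_of_lt_pi_div_two hω0 hω1
  have hmem := mem_cone_iff_repr b hb0 hm hω0 hω1
  have hvec : ∀ x y : ℝ, ∃ v : Plane, b.repr v 0 = x ∧ b.repr v 1 = y := fun x y =>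
    ⟨b.repr.symm !₂[x, y], by simp, by simp⟩
  have hstrict : ∀ A : Plane →L[ℝ] Plane, A '' cone m ω ⊆ interior (cone m ω) →
      StrictlyMapsCone σ (coordMatrix b A) := by
    intro A hA x y hx hxy
    obtain ⟨v, rfl, rfl⟩ := hvec x y
    have hv : v ≠ 0 := fun h => hx (by simp [h])
    have := abs_repr_lt_of_mem_interior_cone b hb0 hm hω0 hω1
      (hA (mem_image_of_mem A ((hmem v).2 ⟨hv, hxy⟩)))
    rwa [repr_clm_apply, repr_clm_apply] at this
  set B : Fin κ → Matrix (Fin 2) (Fin 2) ℝ :=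
    fun i => coordMatrix b (S.lin i : Plane →L[ℝ] Plane) with hB
  have h1 : ∀ i, StrictlyMapsCone σ (B i) := fun i => hstrict _ (hA i)
  have h2 : ∀ i, StrictlyMapsCone σ (B i).transpose := fun i => by
    rw [hB, ← coordMatrix_adjoint]; exact hstrict _ (hAT i)
  -- A cone of slope greater than 1 is replaced by its dual, of slope `σ⁻¹`. Duality exchanges the
  -- conditions on `A` and `Aᵀ`, and `σ⁻¹ ≤ σ` preserves disjointness.
  obtain ⟨τ, hτ0, hτ1, hτσ, h3, h4⟩ : ∃ τ : ℝ, 0 < τ ∧ τ ≤ 1 ∧ τ ≤ σ ∧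
      (∀ i, StrictlyMapsCone τ (B i)) ∧ ∀ i, StrictlyMapsCone τ (B i).transpose := by
    rcases le_total σ 1 with hs | hs
    · exact ⟨σ, hσ0, hs, le_rfl, h1, h2⟩
    · have hinv : σ⁻¹ ≤ 1 := inv_le_one_of_one_le₀ hs
      exact ⟨σ⁻¹, inv_pos.2 hσ0, hinv, hinv.trans hs, fun i => (h2 i).dual hσ0,
        fun i => StrictlyMapsCone.dual hσ0 (by simpa using h1 i)⟩
  choose t ht ht' using fun i => (h3 i).exists_mapsCone hτ0
  choose s hs hs' using fun i => (h4 i).exists_mapsCone hτ0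
  obtain ⟨τ₁, ⟨⟨hp, ht₁⟩, hs₁⟩, hlt⟩ : ∃ τ₁, ((0 < τ₁ ∧ ∀ i, t i ≤ τ₁) ∧ ∀ i, s i ≤ τ₁) ∧ τ₁ < τ := by
    have e : ∀ a < τ, ∀ᶠ x in 𝓝[<] τ, a < x := fun a ha =>
      mem_nhdsWithin_of_mem_nhds (Ioi_mem_nhds ha)
    exact ((((e 0 hτ0).and (eventually_all.2 fun i => (e _ (ht i)).mono fun _ => le_of_lt)).and
      (eventually_all.2 fun i => (e _ (hs i)).mono fun _ => le_of_lt)).and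
      self_mem_nhdsWithin).exists
  refine ⟨b, ⟨B, τ, τ₁, hp, hlt, hτ1, fun i => det_coordMatrix_ne_zero b _,
    fun i => (ht' i).mono le_rfl (ht₁ i), fun i => (hs' i).mono le_rfl (hs₁ i), ?_⟩, fun i => rfl⟩
  intro i j hij z z' hz hz' heq
  have hden : ∀ i z, |z| ≤ τ → B i 0 0 + B i 0 1 * z ≠ 0 := fun i z hz h => by
    have := h3 i 1 z one_ne_zero (by simpa using hz)
    rw [mul_one, mul_one, h, abs_zero, mul_zero] at this
    exact absurd this (not_lt.2 (abs_nonneg _))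
  have hi := hden i z hz
  have hj := hden j z' hz'
  obtain ⟨v, hv0, hv1⟩ := hvec 1 z
  -- With this factor the images of `(1, z)` under `A_i` and of `c(1, z')` under `A_j` have the same
  -- first coordinate; equal slopes then make them equal.
  set c := (B i 0 0 + B i 0 1 * z) / (B j 0 0 + B j 0 1 * z') with hc
  obtain ⟨v', hv0', hv1'⟩ := hvec c (c * z')
  have hc0 : c ≠ 0 := div_ne_zero hi hj
  have hmv : v ∈ cone m ω := (hmem v).2 ⟨fun h => by simp [h] at hv0, by
    rw [hv0, hv1, abs_one, mul_one]; exact hz.trans hτσ⟩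
  have hmv' : v' ∈ cone m ω := (hmem v').2 ⟨fun h => hc0 (by simpa [h] using hv0'.symm), by
    rw [hv0', hv1', abs_mul, mul_comm]; gcongr; exact hz'.trans hτσ⟩
  have hvv : S.lin i v = S.lin j v' := by
    have k0 := fun k v n => repr_clm_apply b (S.lin k : Plane →L[ℝ] Plane) v n
    simp only [ContinuousLinearEquiv.coe_coe] at k0
    rw [slopeMap, slopeMap, div_eq_div_iff hi hj] at heq
    refine ext_repr b ?_ ?_
    · rw [k0, k0, hv0, hv1, hv0', hv1']
      change B i 0 0 * 1 + B i 0 1 * z = B j 0 0 * c + B j 0 1 * (c * z')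
      rw [hc]; field_simp
    · rw [k0, k0, hv0, hv1, hv0', hv1']
      change B i 1 0 * 1 + B i 1 1 * z = B j 1 0 * c + B j 1 1 * (c * z')
      rw [hc]; field_simp; linear_combination heq
  exact eq_empty_iff_forall_notMem.1 (hdisj i j hij) (S.lin i v)
    ⟨mem_image_of_mem _ hmv, hvv ▸ mem_image_of_mem _ hmv'⟩

/-! ### Limit orientations -/

/-- Expanding in eigenvectors of `AᵀA` shows that the largest singular value bounds the norm of `A`,
and `η` attains it. -/
theorem IsLongAxis.exists_norm_le {A : Plane ≃L[ℝ] Plane} {p : ℙ ℝ Plane} (h : IsLongAxis A p) :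
    ∃ η : Plane, ‖η‖ = 1 ∧ (∀ v, ‖A v‖ ≤ ‖A η‖ * ‖v‖) ∧
      ∃ hη : A η ≠ 0, p = Projectivization.mk ℝ (A η) hη := by
  obtain ⟨-, η, hη1, heig, hη0, hp⟩ := h
  refine ⟨η, hη1, fun v => ?_, hη0, hp⟩
  set T : Plane →ₗ[ℝ] Plane := (A : Plane →ₗ[ℝ] Plane) with hT
  have hTA : ∀ v, T v = A v := fun v => rfl
  have hdim : Module.finrank ℝ Plane = 2 := by simp
  set σ := T.singularValues 0 with hσ
  have hη2 : ‖A η‖ ^ 2 = σ ^ 2 := by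
    have : inner ℝ ((A : Plane →L[ℝ] Plane).adjoint (A η)) η = ‖A η‖ ^ 2 := by
      rw [ContinuousLinearMap.adjoint_inner_left]; exact real_inner_self_eq_norm_sq _
    rw [← this, heig, real_inner_smul_left, real_inner_self_eq_norm_sq, hη1]; simp [hσ, hT]
  have hsym := T.isSymmetric_adjoint_comp_self
  set B := hsym.eigenvectorBasis hdim
  have hv : ‖A v‖ ^ 2 = ∑ i, hsym.eigenvalues hdim i * inner ℝ v (B i) ^ 2 := by
    calc ‖A v‖ ^ 2 = inner ℝ ((T.adjoint ∘ₗ T) v) v := by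
          rw [LinearMap.comp_apply, LinearMap.adjoint_inner_left, hTA, real_inner_self_eq_norm_sq]
      _ = ∑ i, inner ℝ ((T.adjoint ∘ₗ T) v) (B i) * inner ℝ (B i) v :=
          (B.sum_inner_mul_inner _ _).symm
      _ = _ := by
          refine Finset.sum_congr rfl fun i _ => ?_
          rw [hsym v (B i), hsym.apply_eigenvectorBasis hdim i, real_inner_comm v (B i)]
          simp only [RCLike.ofReal_real_eq_id, id_eq, real_inner_smul_right]
          change hsym.eigenvalues hdim i * inner ℝ v (B i) * inner ℝ v (B i) = _
          ring
  have hle : ‖A v‖ ^ 2 ≤ (‖A η‖ * ‖v‖) ^ 2 := by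
    rw [hv, mul_pow, hη2, ← B.sum_sq_inner_left v, Finset.mul_sum]
    refine Finset.sum_le_sum fun i _ => ?_
    gcongr
    rw [← T.sq_singularValues_fin hdim i]
    have := T.singularValues_antitone (Nat.zero_le i)
    have h0 := T.singularValues_nonneg i
    gcongr
  exact (sq_le_sq₀ (norm_nonneg _) (by positivity)).1 hle

theorem abs_cross_eq (b : OrthonormalBasis (Fin 2) ℝ Plane) (u v : Plane) :
    |b.repr u 0 * b.repr v 1 - b.repr u 1 * b.repr v 0|
      = Real.sin (vecLineAngle u v) * (‖u‖ * ‖v‖) := by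
  have hs : 0 ≤ Real.sin (vecLineAngle u v) :=
    Real.sin_nonneg_of_nonneg_of_le_pi (vecLineAngle_nonneg u v) (vecLineAngle_le_pi u v)
  have h1 := congrArg (· ^ 2) (abs_inner_eq_cos_vecLineAngle u v)
  simp only [sq_abs, mul_pow] at h1
  rw [inner_eq_repr b, Real.cos_sq', norm_sq_eq_repr b u, norm_sq_eq_repr b v] at h1
  rw [← abs_of_nonneg (by positivity : 0 ≤ Real.sin (vecLineAngle u v) * (‖u‖ * ‖v‖)),
    ← sq_eq_sq_iff_abs_eq_abs, mul_pow, mul_pow, norm_sq_eq_repr b u, norm_sq_eq_repr b v]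
  linear_combination -h1

section System

variable {κ : ℕ} {S : AffineIFS κ} {b : OrthonormalBasis (Fin 2) ℝ Plane} {C : ConeSystem κ}

theorem coordMatrix_linWord (hC : ∀ i, C.mat i = coordMatrix b (S.lin i : Plane →L[ℝ] Plane))
    (w : List (Fin κ)) : coordMatrix b (S.linWord w : Plane →L[ℝ] Plane) = C.word w := by
  induction w with
  | nil => exact coordMatrix_id b
  | cons i w ih =>
    rw [C.word_cons, hC, ← ih, ← coordMatrix_comp]
    rfl

theorem repr_linWord (hC : ∀ i, C.mat i = coordMatrix b (S.lin i : Plane →L[ℝ] Plane))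
    (w : List (Fin κ)) (v : Plane) (k : Fin 2) :
    b.repr (S.linWord w v) k = C.word w k 0 * b.repr v 0 + C.word w k 1 * b.repr v 1 := by
  rw [← coordMatrix_linWord hC, ← repr_clm_apply]
  rfl

/-- The image of any vector lies on the line of slope `C.slopes w 0` up to a vertical error of size
`det / p`, which is small compared with `p`, the upper left entry. -/
theorem repr_linWord_one (hC : ∀ i, C.mat i = coordMatrix b (S.lin i : Plane →L[ℝ] Plane))
    (w : List (Fin κ)) (v : Plane) :
    b.repr (S.linWord w v) 1 = C.slopes w 0 * b.repr (S.linWord w v) 0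
      + b.repr v 1 * ((C.word w).det / C.word w 0 0) := by
  have h := C.word_zero_zero_ne_zero w
  rw [repr_linWord hC, repr_linWord hC, ConeSystem.slopes, slopeMap, Matrix.det_fin_two]
  simp only [mul_zero, add_zero]
  field_simp
  ring

theorem abs_det_div_le (C : ConeSystem κ) (w : List (Fin κ)) :
    |(C.word w).det / C.word w 0 0| ≤ C.θ ^ w.length * |C.word w 0 0| := by
  have h := abs_pos.2 (C.word_zero_zero_ne_zero w)
  rw [abs_div, div_le_iff₀ h, mul_assoc, abs_mul_abs_self, ← sq]
  exact C.abs_det_word_le w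

theorem abs_slopes_zero_le_one (C : ConeSystem κ) (w : List (Fin κ)) : |C.slopes w 0| ≤ 1 :=
  (C.abs_slopes_le w C.τ₁_lt.le le_rfl (by simpa using C.τ_pos.le)).trans C.τ_le_one

/-- The slope of a limit orientation is a limit slope. -/
theorem AffineIFS.IsLimitOrientation.exists_slope
    (hC : ∀ i, C.mat i = coordMatrix b (S.lin i : Plane →L[ℝ] Plane)) {i : ℕ → Fin κ}
    {p : ℙ ℝ Plane} (h : S.IsLimitOrientation i p) :
    ∃ z ∈ C.limitSlopes, b.repr p.rep 1 = z * b.repr p.rep 0 := by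
  obtain ⟨q, hq, hlim⟩ := h
  obtain ⟨z, hz, hconv⟩ := C.exists_tendsto_slopes i
  refine ⟨z, hz, ?_⟩
  set v := p.rep
  have hlen : ∀ n, (prefixWord i n).length = n := fun n => by simp [prefixWord]
  have hpow := tendsto_pow_atTop_nhds_zero_of_lt_one C.θ_pos.le C.θ_lt_one
  have hbound : ∀ᶠ n in atTop, |b.repr v 1 - C.slopes (prefixWord i n) 0 * b.repr v 0|
      ≤ 2 * (Real.sin (lineAngle (q n) p) * ‖v‖ + C.θ ^ n * ‖v‖) := by
    filter_upwards [hq, hpow.eventually (gt_mem_nhds (by norm_num : (0 : ℝ) < 1 / 4))]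
      with n hn hθn
    obtain ⟨η, hη1, hmax, hη0, hqn⟩ := hn.exists_norm_le
    set A := S.linWord (prefixWord i n)
    set f := C.slopes (prefixWord i n) 0
    have hf : |f| ≤ 1 := abs_slopes_zero_le_one C _
    set N := ‖A η‖
    have hN : 0 < N := norm_pos_iff.2 hη0
    have hp : |C.word (prefixWord i n) 0 0| ≤ N := by
      have h1 := abs_repr_le_norm b (A (b 0)) 0
      have h2 := hmax (b 0)
      rw [b.orthonormal.norm_eq_one, mul_one] at h2
      rw [repr_linWord hC] at h1
      simp only [OrthonormalBasis.repr_self, PiLp.single_apply] at h1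
      norm_num at h1
      exact h1.trans h2
    have hY : |b.repr (A η) 1 - f * b.repr (A η) 0| ≤ C.θ ^ n * N := by
      rw [repr_linWord_one hC, add_sub_cancel_left, abs_mul]
      have h1 := abs_repr_le_norm b η 1
      rw [hη1] at h1
      have h2 := abs_det_div_le C (prefixWord i n)
      rw [hlen] at h2
      have h3 := pow_nonneg C.θ_pos.le n
      calc _ ≤ 1 * (C.θ ^ n * |C.word (prefixWord i n) 0 0|) := by gcongr
        _ ≤ _ := by rw [one_mul]; gcongr
    -- Slope at most 1 and error at most `N / 4` give `|Y| ≤ |X| + N / 4`; were `|X| < N / 2`, then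
    -- `X ^ 2 + Y ^ 2` would stay below `(13 / 16) * N ^ 2`.
    have hX : N / 2 ≤ |b.repr (A η) 0| := by
      by_contra hcon
      rw [not_le] at hcon
      have h1 : N ^ 2 = b.repr (A η) 0 ^ 2 + b.repr (A η) 1 ^ 2 := norm_sq_eq_repr b _
      have h2 : |b.repr (A η) 1| ≤ |b.repr (A η) 0| + N / 4 := by
        have e : b.repr (A η) 1 = f * b.repr (A η) 0 + (b.repr (A η) 1 - f * b.repr (A η) 0) := by
          ring
        rw [e]
        refine (abs_add_le _ _).trans (add_le_add ?_ (hY.trans ?_))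
        · rw [abs_mul]; exact mul_le_of_le_one_left (abs_nonneg _) hf
        · nlinarith
      rw [← sq_abs (b.repr (A η) 0), ← sq_abs (b.repr (A η) 1)] at h1
      nlinarith [abs_nonneg (b.repr (A η) 0), abs_nonneg (b.repr (A η) 1)]
    have hcross := abs_cross_eq b (A η) v
    have hangle : vecLineAngle (A η) v = lineAngle (q n) p := by
      rw [hqn, ← lineAngle_mk_mk _ _ hη0 p.rep_nonzero, p.mk_rep]
    rw [hangle] at hcross
    have hv0 := abs_repr_le_norm b v 0
    -- The cross product of `A η` and `v` measures the angle to the limit line; replacing the slope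
    -- of `A η` by `f` costs only the thinness error.
    have hprod : |b.repr (A η) 0| * |b.repr v 1 - f * b.repr v 0|
        ≤ N * (Real.sin (lineAngle (q n) p) * ‖v‖ + C.θ ^ n * ‖v‖) := by
      rw [← abs_mul]
      have e : b.repr (A η) 0 * (b.repr v 1 - f * b.repr v 0)
          = (b.repr (A η) 0 * b.repr v 1 - b.repr (A η) 1 * b.repr v 0)
            + (b.repr (A η) 1 - f * b.repr (A η) 0) * b.repr v 0 := by ring
      rw [e]
      refine (abs_add_le _ _).trans ?_
      rw [hcross, abs_mul]
      have := mul_le_mul hY hv0 (abs_nonneg _) (mul_nonneg (pow_nonneg C.θ_pos.le n) hN.le)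
      nlinarith
    have h5 := (mul_le_mul_of_nonneg_right hX
      (abs_nonneg (b.repr v 1 - f * b.repr v 0))).trans hprod
    have h6 : N * |b.repr v 1 - f * b.repr v 0|
        ≤ N * (2 * (Real.sin (lineAngle (q n) p) * ‖v‖ + C.θ ^ n * ‖v‖)) := by linarith
    exact le_of_mul_le_mul_left h6 hN
  have hzero : Tendsto (fun n => 2 * (Real.sin (lineAngle (q n) p) * ‖v‖ + C.θ ^ n * ‖v‖)) atTop
      (𝓝 0) := by
    have h1 := (Real.continuous_sin.tendsto 0).comp hlim
    rw [Real.sin_zero] at h1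
    simpa using ((h1.mul_const ‖v‖).add (hpow.mul_const ‖v‖)).const_mul 2
  have h1 := squeeze_zero' (Eventually.of_forall fun _ => abs_nonneg _) hbound hzero
  have h2 : Tendsto (fun n => |b.repr v 1 - C.slopes (prefixWord i n) 0 * b.repr v 0|) atTop
      (𝓝 |b.repr v 1 - z * b.repr v 0|) :=
    (tendsto_const_nhds.sub (hconv.mul_const (b.repr v 0))).abs
  have h3 := tendsto_nhds_unique h1 h2
  exact sub_eq_zero.1 (abs_eq_zero.1 h3.symm)

theorem dirLine_notMem_limitOrientations
    (hC : ∀ i, C.mat i = coordMatrix b (S.lin i : Plane →L[ℝ] Plane)) {e : Circ}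
    (he : ∀ z ∈ C.limitSlopes, b.repr (e : Plane) 1 ≠ z * b.repr (e : Plane) 0) :
    dirLine e ∉ S.limitOrientations := by
  rintro ⟨i, hi⟩
  obtain ⟨z, hz, h⟩ := hi.exists_slope hC
  obtain ⟨a, ha⟩ := Projectivization.exists_smul_eq_mk_rep ℝ (e : Plane)
    (ne_zero_of_mem_unit_sphere e)
  refine he z hz ?_
  rw [dirLine, ← ha, Units.smul_def, map_smul] at h
  simp only [PiLp.smul_apply, smul_eq_mul] at h
  have ha0 := a.ne_zero
  exact mul_left_cancel₀ ha0 (by linear_combination h)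

/-- Almost every direction is transversal to a null set of slopes. -/
theorem ae_forall_slope_ne (b : OrthonormalBasis (Fin 2) ℝ Plane) {Z : Set ℝ} (hZ : IsClosed Z)
    (hZ0 : volume Z = 0) :
    ∀ᵐ e : Circ ∂((volume : Measure Plane).toSphere),
      ∀ z ∈ Z, b.repr (e : Plane) 1 ≠ z * b.repr (e : Plane) 0 := by
  set N : Set Circ := {e | b.repr (e : Plane) 0 ≠ 0 ∧
    b.repr (e : Plane) 1 / b.repr (e : Plane) 0 ∈ Z} with hN
  have hmeas : ∀ k, Measurable fun e : Circ => b.repr (e : Plane) k := fun k => by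
    have h : Continuous fun e : Circ => b.repr (e : Plane) k :=
      ((EuclideanSpace.proj k).continuous.comp b.repr.continuous).comp continuous_subtype_val
    exact h.measurable
  have hNmeas : MeasurableSet N :=
    ((hmeas 0) (measurableSet_singleton 0).compl).inter
      (((hmeas 1).div (hmeas 0)) hZ.measurableSet)
  have hN0 : (volume : Measure Plane).toSphere N = 0 := by
    -- The spherical measure of `N` is a multiple of the area of the truncated cone over `N`. That
    -- cone lies in the image of the null set `ℝ × Z` under `(r, z) ↦ r(1, z)`, and a differentiable
    -- map preserves null sets.
    rw [Measure.toSphere_apply' _ hNmeas]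
    have hs : volume {v : Plane | v 1 ∈ Z} = 0 := by
      have h1 := (PiLp.volume_preserving_ofLp (Fin 2)).quasiMeasurePreserving
      have h2 := Measure.quasiMeasurePreserving_eval
        (μ := fun _ : Fin 2 => (volume : Measure ℝ)) 1
      exact (h2.comp h1).preimage_null hZ0
    have hg : DifferentiableOn ℝ (fun v : Plane => v 0 • b 0 + (v 0 * v 1) • b 1)
        {v : Plane | v 1 ∈ Z} := by
      have h : ∀ k, Differentiable ℝ fun v : Plane => v k := fun k =>
        (EuclideanSpace.proj (𝕜 := ℝ) k).differentiable
      exact (((h 0).smul_const _).add (((h 0).mul (h 1)).smul_const _)).differentiableOn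
    have himg := addHaar_image_eq_zero_of_differentiableOn_of_addHaar_eq_zero volume hg hs
    refine mul_eq_zero_of_right _ (measure_mono_null ?_ himg)
    rintro _ ⟨t, -, _, ⟨e, ⟨he0, heZ⟩, rfl⟩, rfl⟩
    refine ⟨!₂[t * b.repr (e : Plane) 0, b.repr (e : Plane) 1 / b.repr (e : Plane) 0],
      by simpa using heZ, ?_⟩
    refine ext_repr b ?_ ?_
    · simp
    · simp
      field_simp
  rw [ae_iff]
  refine measure_mono_null ?_ hN0
  intro e he
  simp only [mem_ofPred_eq, not_forall, not_not] at he
  obtain ⟨z, hz, h⟩ := he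
  have h0 : b.repr (e : Plane) 0 ≠ 0 := fun h0 => by
    rw [h0, mul_zero] at h
    exact ne_zero_of_mem_unit_sphere e ((eq_zero_iff_repr b _).2 ⟨h0, h⟩)
  refine ⟨h0, ?_⟩
  rwa [h, mul_div_assoc, div_self h0, mul_one]

/-! ### Cylinders -/

theorem mapWord_sub (w : List (Fin κ)) (x y : Plane) :
    S.mapWord w x - S.mapWord w y = S.linWord w (x - y) := by
  induction w with
  | nil => rfl
  | cons i w ih =>
    simp only [AffineIFS.mapWord, AffineIFS.linWord, Function.comp_apply, AffineIFS.map,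
      ContinuousLinearEquiv.trans_apply]
    rw [← ih, map_sub]
    abel

theorem mapWord_append (v w : List (Fin κ)) (x : Plane) :
    S.mapWord (v ++ w) x = S.mapWord v (S.mapWord w x) := by
  induction v with
  | nil => rfl
  | cons i v ih => simp [AffineIFS.mapWord, ih]

theorem AffineIFS.IsSelfAffineSet.map_mem {E : Set Plane} (hE : S.IsSelfAffineSet E) (i : Fin κ)
    {x : Plane} (hx : x ∈ E) : S.map i x ∈ E := by
  rw [hE.2.2]
  exact mem_iUnion.2 ⟨i, mem_image_of_mem _ hx⟩

theorem AffineIFS.IsSelfAffineSet.mapWord_mem {E : Set Plane} (hE : S.IsSelfAffineSet E)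
    (w : List (Fin κ)) {x : Plane} (hx : x ∈ E) : S.mapWord w x ∈ E := by
  induction w with
  | nil => exact hx
  | cons i w ih => exact hE.map_mem i ih

theorem AffineIFS.IsSelfAffineSet.mapWord_image_subset {E : Set Plane} (hE : S.IsSelfAffineSet E)
    (w : List (Fin κ)) : S.mapWord w '' E ⊆ E := by
  rintro _ ⟨x, hx, rfl⟩
  exact hE.mapWord_mem w hx

theorem AffineIFS.IsSelfAffineSet.exists_mem_mapWord_append {E : Set Plane}
    (hE : S.IsSelfAffineSet E) {w : List (Fin κ)} {x : Plane} (hx : x ∈ S.mapWord w '' E) :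
    ∃ i, x ∈ S.mapWord (w ++ [i]) '' E := by
  obtain ⟨y, hy, rfl⟩ := hx
  rw [hE.2.2] at hy
  obtain ⟨i, z, hz, rfl⟩ := mem_iUnion.1 hy
  exact ⟨i, z, hz, by rw [mapWord_append]; rfl⟩

theorem projAlong_apply (e : Circ) (v : Plane) :
    projAlong e v = v - (inner ℝ (e : Plane) v : ℝ) • (e : Plane) := by
  rw [projAlong, Submodule.starProjection_orthogonal']
  simp [Submodule.starProjection_unit_singleton ℝ (norm_eq_of_mem_sphere e)]

theorem AffineIFS.IsSelfAffineSet.exists_word_length {E : Set Plane}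
    (hE : S.IsSelfAffineSet E) (n : ℕ) : ∃ w : List (Fin κ), w.length = n := by
  obtain ⟨x, hx⟩ := hE.1
  rw [hE.2.2] at hx
  obtain ⟨i, -⟩ := mem_iUnion.1 hx
  exact ⟨List.replicate n i, by simp⟩

/-- A self-affine set satisfying the projection condition has positive width in the directions
dual to the cone. -/
theorem exists_width (hC : ∀ i, C.mat i = coordMatrix b (S.lin i : Plane →L[ℝ] Plane))
    {E : Set Plane} (hE : S.IsSelfAffineSet E) (hproj : S.ProjectionCondition E) :
    ∃ η > 0, ∀ b₀ b₁ : ℝ, C.τ * |b₁| ≤ |b₀| → ∃ x ∈ E, ∃ y ∈ E,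
      η * |b₀| ≤ |b₀ * b.repr (x - y) 0 + b₁ * b.repr (x - y) 1| := by
  have hτ := C.τ_pos
  -- The kernel of `(X, Y) ↦ X + sY` is spanned by `(-s, 1)`, which is steeper than every limit
  -- slope. A cylinder projected along it is a nondegenerate interval, so the functional is not
  -- constant on `E`.
  have hpt : ∀ s ∈ Icc (-(C.τ⁻¹)) C.τ⁻¹, ∃ x ∈ E, ∃ y ∈ E,
      b.repr (x - y) 0 + s * b.repr (x - y) 1 ≠ 0 := by
    intro s hs
    set n := √(1 + s ^ 2)
    have hn2 : n ^ 2 = 1 + s ^ 2 := Real.sq_sqrt (by positivity)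
    have hn : 0 < n := Real.sqrt_pos.2 (by positivity)
    set u : Plane := b.repr.symm !₂[-s / n, 1 / n]
    have hu0 : b.repr u 0 = -s / n := by simp [u]
    have hu1 : b.repr u 1 = 1 / n := by simp [u]
    have hu : ‖u‖ = 1 := by
      have : ‖u‖ ^ 2 = 1 ^ 2 := by
        rw [norm_sq_eq_repr b, hu0, hu1]
        field_simp
        rw [hn2]; ring
      exact (sq_eq_sq₀ (norm_nonneg _) zero_le_one).1 this
    set e : Circ := ⟨u, by simpa using hu⟩
    have he : dirLine e ∉ S.limitOrientations := by
      refine dirLine_notMem_limitOrientations hC fun z hz h => ?_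
      change b.repr u 1 = z * b.repr u 0 at h
      rw [hu0, hu1] at h
      have h1 : z * s = -1 := by field_simp at h; linarith
      -- Limit slopes satisfy `|z| ≤ τ₁` and `|s| ≤ 1 / τ`, so `z * s = -1` is impossible.
      have h2 : |z * s| ≤ C.θ := by
        rw [abs_mul, ConeSystem.θ, div_eq_mul_inv]
        exact mul_le_mul (C.abs_le_of_mem_limitSlopes hz) (abs_le.2 hs) (abs_nonneg _)
          C.τ₁_pos.le
      rw [h1, abs_neg, abs_one] at h2
      exact absurd h2 (not_le.2 C.θ_lt_one)
    obtain ⟨n₀, hn₀⟩ := hproj.2 e he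
    obtain ⟨w, hw⟩ := hE.exists_word_length n₀
    obtain ⟨p, q, hpq, himg⟩ := hn₀ w hw.ge
    obtain ⟨x, hx, hxp⟩ : p ∈ projAlong e '' (S.mapWord w '' E) :=
      himg ▸ left_mem_segment ℝ p q
    obtain ⟨y, hy, hyq⟩ : q ∈ projAlong e '' (S.mapWord w '' E) :=
      himg ▸ right_mem_segment ℝ p q
    refine ⟨x, hE.mapWord_image_subset w hx, y, hE.mapWord_image_subset w hy, fun h => hpq ?_⟩
    rw [← hxp, ← hyq, ← sub_eq_zero, ← map_sub, projAlong_apply, inner_eq_repr b, sub_eq_zero]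
    set d := x - y
    have hd : b.repr d 0 = -s * b.repr d 1 := by linarith
    change d = (b.repr u 0 * b.repr d 0 + b.repr u 1 * b.repr d 1) • u
    rw [hu0, hu1, hd]
    refine ext_repr b ?_ ?_
    · rw [map_smul, PiLp.smul_apply, smul_eq_mul, hu0, hd]
      field_simp
      rw [hn2]; ring
    · rw [map_smul, PiLp.smul_apply, smul_eq_mul, hu1]
      field_simp
      rw [hn2]; ring
  obtain ⟨η, hη, H⟩ : ∃ η > 0, ∀ s ∈ Icc (-(C.τ⁻¹)) C.τ⁻¹, ∃ x ∈ E, ∃ y ∈ E,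
      η ≤ |b.repr (x - y) 0 + s * b.repr (x - y) 1| := by
    refine isCompact_Icc.induction_on (p := fun I => ∃ η > 0, ∀ s ∈ I, ∃ x ∈ E, ∃ y ∈ E,
      η ≤ |b.repr (x - y) 0 + s * b.repr (x - y) 1|) ⟨1, one_pos, by simp⟩ ?_ ?_ ?_
    · rintro I J hIJ ⟨η, hη, h⟩
      exact ⟨η, hη, fun s hs => h s (hIJ hs)⟩
    · rintro I J ⟨η, hη, h⟩ ⟨η', hη', h'⟩
      refine ⟨min η η', lt_min hη hη', ?_⟩
      rintro s (hs | hs)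
      · obtain ⟨x, hx, y, hy, hxy⟩ := h s hs
        exact ⟨x, hx, y, hy, (min_le_left _ _).trans hxy⟩
      · obtain ⟨x, hx, y, hy, hxy⟩ := h' s hs
        exact ⟨x, hx, y, hy, (min_le_right _ _).trans hxy⟩
    · intro s hs
      obtain ⟨x, hx, y, hy, hxy⟩ := hpt s hs
      have hcont : Continuous fun r : ℝ => |b.repr (x - y) 0 + r * b.repr (x - y) 1| := by
        fun_prop
      have hev := hcont.continuousAt.eventually (lt_mem_nhds (half_lt_self (abs_pos.2 hxy)))
      exact ⟨_, mem_nhdsWithin_of_mem_nhds hev, _, half_pos (abs_pos.2 hxy),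
        fun r hr => ⟨x, hx, y, hy, le_of_lt hr⟩⟩
  refine ⟨η, hη, fun b₀ b₁ hb => ?_⟩
  rcases eq_or_ne b₀ 0 with rfl | hb₀
  · obtain ⟨x, hx⟩ := hE.1
    exact ⟨x, hx, x, hx, by simp⟩
  · have h0 := abs_pos.2 hb₀
    obtain ⟨x, hx, y, hy, hxy⟩ := H (b₁ / b₀) (by
      rw [mem_Icc, ← abs_le, abs_div, div_le_iff₀ h0, inv_mul_eq_div, le_div_iff₀ hτ]
      linarith)
    refine ⟨x, hx, y, hy, ?_⟩
    have e : b₀ * b.repr (x - y) 0 + b₁ * b.repr (x - y) 1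
        = (b.repr (x - y) 0 + b₁ / b₀ * b.repr (x - y) 1) * b₀ := by field_simp
    rw [e, abs_mul]
    gcongr

end System

/-! ### The visible part -/

/-- The vector `e` rotated by a right angle, in the orientation given by the basis `b`. -/
noncomputable def perp (b : OrthonormalBasis (Fin 2) ℝ Plane) (e : Plane) : Plane :=
  b.repr.symm !₂[-b.repr e 1, b.repr e 0]

theorem inner_perp (b : OrthonormalBasis (Fin 2) ℝ Plane) (e v : Plane) :
    inner ℝ (perp b e) v = b.repr e 0 * b.repr v 1 - b.repr e 1 * b.repr v 0 := by
  rw [inner_eq_repr b, perp]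
  simp
  ring

theorem norm_sq_eq_inner_perp (b : OrthonormalBasis (Fin 2) ℝ Plane) {e : Plane} (he : ‖e‖ = 1)
    (v : Plane) : ‖v‖ ^ 2 = inner ℝ (perp b e) v ^ 2 + inner ℝ e v ^ 2 := by
  have h := norm_sq_eq_repr b e
  rw [he] at h
  rw [inner_perp, inner_eq_repr b, norm_sq_eq_repr b v]
  linear_combination (b.repr v 0 ^ 2 + b.repr v 1 ^ 2) * h

theorem norm_perp (b : OrthonormalBasis (Fin 2) ℝ Plane) {e : Plane} (he : ‖e‖ = 1) :
    ‖perp b e‖ = 1 := by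
  have h : ‖perp b e‖ ^ 2 = 1 ^ 2 := by
    rw [← he, norm_sq_eq_repr b, norm_sq_eq_repr b, perp]
    simp
    ring
  exact (sq_eq_sq₀ (norm_nonneg _) zero_le_one).1 h

theorem visiblePart_subset (e : Circ) (E : Set Plane) : visiblePart e E ⊆ E := fun x hx => by
  have : x ∈ (fun y => x + y) '' halfLine e ∩ E := by rw [hx]; rfl
  exact this.2

/-- Otherwise `g` would be a second point of `E` on the half line from `x`. -/
theorem inner_le_of_mem_visiblePart (b : OrthonormalBasis (Fin 2) ℝ Plane) {e : Circ}
    {E : Set Plane} {x g : Plane} (hx : x ∈ visiblePart e E) (hg : g ∈ E)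
    (h : inner ℝ (perp b e) g = inner ℝ (perp b e) x) :
    inner ℝ (e : Plane) g ≤ inner ℝ (e : Plane) x := by
  by_contra hcon
  rw [not_le] at hcon
  have he := norm_eq_of_mem_sphere e
  have hgx : g = x + (inner ℝ (e : Plane) g - inner ℝ (e : Plane) x) • (e : Plane) := by
    rw [← sub_eq_zero, ← norm_eq_zero, ← sq_eq_zero_iff, norm_sq_eq_inner_perp b he]
    have h2 : inner ℝ (perp b e) (e : Plane) = 0 := by rw [inner_perp]; ring
    simp only [inner_sub_right, inner_add_right, real_inner_smul_right, h, h2,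
      real_inner_self_eq_norm_sq, he]
    ring
  have hmem : g ∈ (fun y => x + y) '' halfLine e ∩ E :=
    ⟨⟨_, ⟨_, (sub_pos.2 hcon).le, rfl⟩, hgx.symm⟩, hg⟩
  rw [hx] at hmem
  rw [mem_singleton_iff.1 hmem] at hcon
  exact lt_irrefl _ hcon

/-- The highest point of the compact fibre of `E` through `x` is visible, so the visible part has
the full projection of `E`. -/
theorem exists_mem_visiblePart (b : OrthonormalBasis (Fin 2) ℝ Plane) (e : Circ) {E : Set Plane}
    (hE : IsCompact E) {x : Plane} (hx : x ∈ E) :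
    ∃ y ∈ visiblePart e E, inner ℝ (perp b e) y = inner ℝ (perp b e) x := by
  have hcont : ∀ u : Plane, Continuous fun v : Plane => (inner ℝ u v : ℝ) := fun u => by fun_prop
  have hK : IsCompact (E ∩ {y | inner ℝ (perp b e) y = inner ℝ (perp b e) x}) :=
    hE.inter_right (isClosed_eq (hcont _) continuous_const)
  obtain ⟨y, ⟨hyE, hyx⟩, hmax⟩ := hK.exists_isMaxOn ⟨x, hx, rfl⟩ (hcont (e : Plane)).continuousOn
  refine ⟨y, ?_, hyx⟩
  have he := norm_eq_of_mem_sphere e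
  have h2 : inner ℝ (perp b e) (e : Plane) = 0 := by rw [inner_perp]; ring
  refine Subset.antisymm ?_ ?_
  · rintro _ ⟨⟨_, ⟨t, ht, rfl⟩, rfl⟩, hz⟩
    have h3 := hmax (a := y + t • (e : Plane)) ⟨hz, by
      simp only [mem_ofPred_eq] at hyx ⊢
      rw [inner_add_right, real_inner_smul_right, h2, hyx]; ring⟩
    simp only [mem_ofPred_eq, inner_add_right, real_inner_smul_right, real_inner_self_eq_norm_sq,
      he] at h3
    have : t = 0 := by linarith
    simp [this]
  · rintro _ rfl
    exact ⟨⟨0, ⟨0, le_rfl, by simp⟩, by simp⟩, hyE⟩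

/-- If the points of `B` see, on one side, everything up to a Lipschitz error, then `B` is covered
by linearly many small balls. -/
theorem exists_finset_cover_of_almost_monotone {T h : Plane →ₗ[ℝ] ℝ}
    (hT : ∀ v, |T v| ≤ ‖v‖) (hh : ∀ v, |h v| ≤ ‖v‖) (hTh : ∀ v, ‖v‖ ≤ |T v| + |h v|)
    {B : Set Plane} {x₀ : Plane} {K R ρ : ℝ} (hK : 0 ≤ K) (hR : 0 < R) (hρ : 0 < ρ)
    (hB : B ⊆ Metric.closedBall x₀ R)
    (hmono : ∀ x ∈ B, ∀ y ∈ B, T x ≤ T y → h x - K * (T y - T x + ρ * R) ≤ h y) :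
    ∃ F : Finset Plane, (F : Set Plane) ⊆ B ∧
      B ⊆ ⋃ y ∈ F, Metric.closedBall y ((K ^ 2 + 3 * K + 2) * (ρ * R)) ∧
      (F.card : ℝ) ≤ 2 * (K + 2) / ρ + 1 := by
  have hρR : 0 < ρ * R := mul_pos hρ hR
  have hcard : 2 * (K + 2) / ρ + 1 = 2 * (K + 2) * R / (ρ * R) + 1 := by field_simp
  rw [hcard]
  -- The weight `K + 1` exceeds the Lipschitz constant by 1: if `T x ≤ T y`, then `U y - U x` is at
  -- least `T y - T x - KρR`. So if `U` differs by at most `ρR`, both `T` and `h` differ by a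
  -- multiple of `ρR`.
  refine exists_finset_cover_of_bounded_function (U := fun x => h x + (K + 1) * T x)
    (a := h x₀ + (K + 1) * T x₀ - (K + 2) * R) hρR (by positivity) ?_ ?_
  · intro x hx
    have h1 : ‖x - x₀‖ ≤ R := by rw [← dist_eq_norm]; exact hB hx
    have h2 := abs_le.1 ((hT (x - x₀)).trans h1)
    have h3 := abs_le.1 ((hh (x - x₀)).trans h1)
    rw [map_sub] at h2 h3
    constructor <;> nlinarith
  · have key : ∀ x ∈ B, ∀ y ∈ B, T x ≤ T y →
        |(h x + (K + 1) * T x) - (h y + (K + 1) * T y)| ≤ ρ * R →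
        dist x y ≤ (K ^ 2 + 3 * K + 2) * (ρ * R) := by
      intro x hx y hy hxy hU
      have h1 := hmono x hx y hy hxy
      rw [abs_le] at hU
      have h2 : T y - T x ≤ (1 + K) * (ρ * R) := by nlinarith
      have h3 := hTh (y - x)
      rw [map_sub, map_sub, abs_of_nonneg (sub_nonneg.2 hxy)] at h3
      have h4 : |h y - h x| ≤ (K * (K + 2) + 1) * (ρ * R) := by
        rw [abs_le]
        constructor <;> nlinarith [mul_le_mul_of_nonneg_left h2 hK,
          mul_nonneg (mul_nonneg hK hK) hρR.le, mul_nonneg hK hρR.le]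
      rw [dist_comm, dist_eq_norm]
      nlinarith
    intro x hx y hy hU
    rcases le_total (T x) (T y) with hxy | hxy
    · exact key x hx y hy hxy hU
    · rw [dist_comm]
      exact key y hy x hx hxy (by rwa [abs_sub_comm])

/-- The set `G` is a piece of `E` through `x` which is, up to the error `δ`, a Lipschitz graph over
an interval with respect to the coordinates `T` and `h`. -/
structure IsGraphPiece (T h : Plane →ₗ[ℝ] ℝ) (E : Set Plane) (K δ : ℝ) (x : Plane)
    (G : Set Plane) : Prop where
  subset : G ⊆ E
  mem : x ∈ G
  abs_le : ∀ y ∈ G, ∀ y' ∈ G, |h (y - y')| ≤ K * (|T (y - y')| + δ)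
  exists_eq : ∀ y ∈ G, ∀ y' ∈ G, ∀ s ∈ uIcc (T y) (T y'), ∃ g ∈ G, T g = s

theorem IsGraphPiece.neg {T h : Plane →ₗ[ℝ] ℝ} {E : Set Plane} {K δ : ℝ} {x : Plane}
    {G : Set Plane} (hG : IsGraphPiece T h E K δ x G) : IsGraphPiece (-T) h E K δ x G where
  subset := hG.subset
  mem := hG.mem
  abs_le y hy y' hy' := by
    simpa [abs_sub_comm (T y') (T y)] using hG.abs_le y hy y' hy'
  exists_eq y hy y' hy' s hs := by
    obtain ⟨g, hg, hgs⟩ := hG.exists_eq y hy y' hy' (-s) (by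
      simp only [LinearMap.neg_apply, mem_uIcc] at hs ⊢
      rcases hs with hs | hs
      · right; constructor <;> linarith [hs.1, hs.2]
      · left; constructor <;> linarith [hs.1, hs.2])
    exact ⟨g, hg, by simp [hgs]⟩

/-- The piece through `x` reaches past the ball on the right, so it has a point `g` over `T x'` for
every `x'` of the ball to the right of `x`. Then `h x' ≥ h g` by visibility, and `h g` is almost at
least `h x - K(T x' - T x)`. -/
theorem exists_finset_cover_one_sided {T h : Plane →ₗ[ℝ] ℝ}
    (hT : ∀ v, |T v| ≤ ‖v‖) (hh : ∀ v, |h v| ≤ ‖v‖) (hTh : ∀ v, ‖v‖ ≤ |T v| + |h v|)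
    {E F : Set Plane} (hvis : ∀ x ∈ F, ∀ g ∈ E, T g = T x → h g ≤ h x) {x₀ : Plane}
    {K R ρ : ℝ} (hK : 0 ≤ K) (hR : 0 < R) (hρ : 0 < ρ) :
    ∃ t : Finset Plane, (t : Set Plane) ⊆ F ∧
      {x ∈ F ∩ Metric.closedBall x₀ R | ∃ G, IsGraphPiece T h E K (ρ * R) x G ∧
        ∃ y ∈ G, T x₀ + R ≤ T y} ⊆
        ⋃ y ∈ t, Metric.closedBall y ((K ^ 2 + 3 * K + 2) * (ρ * R)) ∧
      (t.card : ℝ) ≤ 2 * (K + 2) / ρ + 1 := by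
  obtain ⟨t, ht, h1, h2⟩ := exists_finset_cover_of_almost_monotone hT hh hTh hK hR hρ
    (B := {x ∈ F ∩ Metric.closedBall x₀ R | ∃ G, IsGraphPiece T h E K (ρ * R) x G ∧
        ∃ y ∈ G, T x₀ + R ≤ T y}) (fun x hx => hx.1.2) (by
      rintro x ⟨⟨hxF, hxR⟩, G, hG, y, hyG, hy⟩ x' ⟨⟨hxF', hxR'⟩, -⟩ hxx
      have h1 : ‖x' - x₀‖ ≤ R := by rw [← dist_eq_norm]; exact hxR'
      have h2 := (abs_le.1 ((hT (x' - x₀)).trans h1)).2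
      rw [map_sub] at h2
      obtain ⟨g, hg, hgT⟩ := hG.exists_eq x hG.mem y hyG (T x')
        (Icc_subset_uIcc ⟨hxx, by linarith⟩)
      have h3 := hG.abs_le x hG.mem g hg
      rw [map_sub, map_sub, hgT, abs_sub_comm (T x), abs_of_nonneg (sub_nonneg.2 hxx)] at h3
      have h4 := hvis x' hxF' g (hG.subset hg) hgT
      linarith [(abs_le.1 h3).2])
  exact ⟨t, fun y hy => (ht hy).1.1, h1, h2⟩

theorem exists_finset_cover_of_graphPieces {T h : Plane →ₗ[ℝ] ℝ}
    (hT : ∀ v, |T v| ≤ ‖v‖) (hh : ∀ v, |h v| ≤ ‖v‖) (hTh : ∀ v, ‖v‖ ≤ |T v| + |h v|)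
    {E F : Set Plane} (hFE : F ⊆ E) (hvis : ∀ x ∈ F, ∀ g ∈ E, T g = T x → h g ≤ h x)
    {x₀ : Plane} {K R ρ : ℝ} (hK : 0 ≤ K) (hR : 0 < R) (hρ : 0 < ρ)
    (hG : ∀ x ∈ E, ∃ G, IsGraphPiece T h E K (ρ * R) x G ∧
      ∃ y ∈ G, ∃ y' ∈ G, 4 * R ≤ |T (y - y')|) :
    ∃ t : Finset Plane, (t : Set Plane) ⊆ F ∧ F ∩ Metric.closedBall x₀ R ⊆
        ⋃ y ∈ t, Metric.closedBall y ((K ^ 2 + 3 * K + 2) * (ρ * R)) ∧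
      (t.card : ℝ) ≤ 2 * (2 * (K + 2) / ρ + 1) := by
  classical
  obtain ⟨t₁, h11, h12, h13⟩ := exists_finset_cover_one_sided hT hh hTh hvis (x₀ := x₀) hK hR hρ
  obtain ⟨t₂, h21, h22, h23⟩ := exists_finset_cover_one_sided (T := -T) (h := h) (E := E) (F := F)
    (fun v => by simpa using hT v) hh (fun v => by simpa using hTh v)
    (fun x hx g hg e => hvis x hx g hg (by simpa using e)) (x₀ := x₀) hK hR hρ
  refine ⟨t₁ ∪ t₂, by simp [h11, h21], ?_, ?_⟩
  · intro x hx
    rw [Finset.set_biUnion_union]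
    obtain ⟨G, hGx, y, hy, y', hy', hyy⟩ := hG x (hFE hx.1)
    -- The projected ball has length `2R`, so a piece of length `4R` reaches one of its ends. The
    -- left case is the right one for `-T`.
    have hsep : (∃ y ∈ G, T x₀ + R ≤ T y) ∨ ∃ y ∈ G, (-T) x₀ + R ≤ (-T) y := by
      by_contra! hcon
      have a1 := hcon.1 y hy
      have a2 := hcon.1 y' hy'
      have a3 := hcon.2 y hy
      have a4 := hcon.2 y' hy'
      simp only [LinearMap.neg_apply] at a3 a4
      rw [map_sub] at hyy
      have : |T y - T y'| < 4 * R := by rw [abs_lt]; constructor <;> linarith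
      linarith
    rcases hsep with hs | hs
    · exact Or.inl (h12 ⟨hx, G, hGx, hs⟩)
    · exact Or.inr (h22 ⟨hx, G, hGx.neg, hs⟩)
  · have : ((t₁ ∪ t₂).card : ℝ) ≤ t₁.card + t₂.card := by exact_mod_cast Finset.card_union_le _ _
    linarith

/-! ### Cylinders are graph pieces -/

section System

variable {κ : ℕ} {S : AffineIFS κ} {b : OrthonormalBasis (Fin 2) ℝ Plane} {C : ConeSystem κ}

theorem exists_norm_linWord_le (S : AffineIFS κ) :
    ∃ r : ℝ, 0 ≤ r ∧ r < 1 ∧ ∀ (w : List (Fin κ)) (v : Plane),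
      ‖S.linWord w v‖ ≤ r ^ w.length * ‖v‖ := by
  have e : ∀ a < (1 : ℝ), ∀ᶠ x in 𝓝[<] (1 : ℝ), a < x := fun a ha =>
    mem_nhdsWithin_of_mem_nhds (Ioi_mem_nhds ha)
  obtain ⟨r, ⟨h0, hr⟩, h1⟩ := (((e 0 one_pos).and
    (eventually_all.2 fun i => e _ (S.contractive i))).and self_mem_nhdsWithin).exists
  refine ⟨r, h0.le, h1, fun w v => ?_⟩
  induction w with
  | nil => simp [AffineIFS.linWord]
  | cons i w ih =>
    calc ‖S.lin i (S.linWord w v)‖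
        ≤ ‖(S.lin i : Plane →L[ℝ] Plane)‖ * ‖S.linWord w v‖ :=
          (S.lin i : Plane →L[ℝ] Plane).le_opNorm _
      _ ≤ r * (r ^ w.length * ‖v‖) := by gcongr; exact (hr i).le
      _ = r ^ (i :: w).length * ‖v‖ := by rw [List.length_cons, pow_succ']; ring

/-- In the product formula for the upper left entry the cross term is at most `τ₁` times the main
term, so no cancellation occurs and one more letter shrinks the entry by a bounded factor only. -/
theorem exists_le_word_append (C : ConeSystem κ) :
    ∃ c : ℝ, 0 < c ∧ c ≤ 1 ∧ ∀ (w : List (Fin κ)) (i : Fin κ),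
      c * |C.word w 0 0| ≤ |C.word (w ++ [i]) 0 0| := by
  have e : ∀ a > (0 : ℝ), ∀ᶠ x in 𝓝[>] (0 : ℝ), x < a := fun a ha =>
    mem_nhdsWithin_of_mem_nhds (Iio_mem_nhds ha)
  obtain ⟨a, ⟨h1, ha⟩, h0⟩ := (((e 1 one_pos).and (eventually_all.2 fun i =>
    e _ (abs_pos.2 (C.word_zero_zero_ne_zero [i])))).and self_mem_nhdsWithin).exists
  have h0 : 0 < a := h0
  have ht := C.τ₁_pos
  have ht1 := C.τ₁_lt_one
  refine ⟨(1 - C.τ₁) * a, mul_pos (by linarith) h0, by nlinarith, fun w i => ?_⟩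
  have hp : C.word (w ++ [i]) 0 0
      = C.word w 0 0 * C.word [i] 0 0 + C.word w 0 1 * C.word [i] 1 0 := by
    rw [C.word_append, Matrix.mul_apply, Fin.sum_univ_two]
  have h2 : |C.word w 0 1 * C.word [i] 1 0| ≤ C.τ₁ * (|C.word w 0 0| * |C.word [i] 0 0|) := by
    rw [abs_mul]
    calc _ ≤ (C.τ₁ * |C.word w 0 0|) * (C.τ₁ * |C.word [i] 0 0|) := by
          gcongr
          · exact C.abs_word_zero_one_le w
          · exact C.abs_word_one_zero_le [i]
      _ = C.τ₁ * (C.τ₁ * (|C.word w 0 0| * |C.word [i] 0 0|)) := by ring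
      _ ≤ C.τ₁ * (1 * (|C.word w 0 0| * |C.word [i] 0 0|)) := by gcongr
      _ = _ := by rw [one_mul]
  have h3 := abs_sub_abs_le_abs_sub (C.word w 0 0 * C.word [i] 0 0)
    (-(C.word w 0 1 * C.word [i] 1 0))
  rw [abs_neg, sub_neg_eq_add, ← hp, abs_mul (C.word w 0 0)] at h3
  have h4 : (1 - C.τ₁) * (|C.word w 0 0| * a)
      ≤ (1 - C.τ₁) * (|C.word w 0 0| * |C.word [i] 0 0|) := by
    have := (ha i).le
    gcongr
  linarith

/-- Every point of the self-affine set lies in a long cylinder whose size is comparable to a given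
small number. -/
theorem exists_word_of_size (hC : ∀ i, C.mat i = coordMatrix b (S.lin i : Plane →L[ℝ] Plane))
    {E : Set Plane} (hE : S.IsSelfAffineSet E) :
    ∃ c > 0, ∀ N : ℕ, ∃ r₀ > 0, ∀ r, 0 < r → r ≤ r₀ → ∀ x ∈ E, ∃ w : List (Fin κ),
      N ≤ w.length ∧ x ∈ S.mapWord w '' E ∧ r ≤ |C.word w 0 0| ∧ c * |C.word w 0 0| ≤ r := by
  obtain ⟨c, hc0, hc1, hc⟩ := exists_le_word_append C
  obtain ⟨q, hq0, hq1, hq⟩ := exists_norm_linWord_le S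
  have hlow : ∀ w, c ^ w.length ≤ |C.word w 0 0| := by
    intro w
    induction w using List.reverseRecOn with
    | nil => simp
    | append_singleton w i ih =>
      rw [List.length_append, List.length_singleton, pow_succ']
      exact (mul_le_mul_of_nonneg_left ih hc0.le).trans (hc w i)
  have hup : ∀ w, |C.word w 0 0| ≤ q ^ w.length := by
    intro w
    have h1 := abs_repr_le_norm b (S.linWord w (b 0)) 0
    have h2 := hq w (b 0)
    rw [b.orthonormal.norm_eq_one, mul_one] at h2
    rw [repr_linWord hC] at h1
    simp only [OrthonormalBasis.repr_self, PiLp.single_apply] at h1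
    norm_num at h1
    exact h1.trans h2
  -- This threshold lies below `c ^ (N + 1)`: words shorter than `N` have an entry too large to be
  -- of size `r`.
  refine ⟨c, hc0, fun N => ⟨c * c ^ N / 2, by positivity, fun r hr hr' x hx => ?_⟩⟩
  have hcN : c * c ^ N / 2 < c * c ^ N := half_lt_self (by positivity)
  -- Follow the cylinders containing `x` and stop just before the entry drops below `r`. The descent
  -- ends because the entries decay like `q ^ n`.
  have hdich : ∀ n : ℕ, (∃ w : List (Fin κ), x ∈ S.mapWord w '' E ∧ r ≤ |C.word w 0 0| ∧
      c * |C.word w 0 0| ≤ r) ∨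
      ∃ w : List (Fin κ), w.length = n ∧ x ∈ S.mapWord w '' E ∧ r ≤ |C.word w 0 0| := by
    intro n
    induction n with
    | zero =>
      refine Or.inr ⟨[], rfl, ⟨x, hx, rfl⟩, ?_⟩
      have : c * c ^ N ≤ 1 := by rw [← pow_succ']; exact pow_le_one₀ hc0.le hc1
      simp only [ConeSystem.word_nil, Matrix.one_apply_eq, abs_one]
      linarith
    | succ n ih =>
      rcases ih with h | ⟨w, hwn, hxw, hrw⟩
      · exact Or.inl h
      · obtain ⟨i, hi⟩ := hE.exists_mem_mapWord_append hxw
        rcases le_or_gt r |C.word (w ++ [i]) 0 0| with h | h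
        · exact Or.inr ⟨w ++ [i], by simp [hwn], hi, h⟩
        · exact Or.inl ⟨w, hxw, hrw, (hc w i).trans h.le⟩
  obtain ⟨n, hn⟩ := exists_pow_lt_of_lt_one hr hq1
  rcases hdich n with ⟨w, hxw, hrw, hcw⟩ | ⟨w, hwn, hxw, hrw⟩
  · refine ⟨w, ?_, hxw, hrw, hcw⟩
    by_contra hcon
    have h1 : c ^ N ≤ c ^ w.length := pow_le_pow_of_le_one hc0.le hc1 (not_le.1 hcon).le
    have h2 := mul_le_mul_of_nonneg_left (h1.trans (hlow w)) hc0.le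
    linarith
  · have := hup w
    rw [hwn] at this
    linarith

/-- A direction that is not a limit direction is uniformly transversal to all long cylinders. -/
theorem exists_transversality (C : ConeSystem κ) {e₀ e₁ : ℝ}
    (he : ∀ z ∈ C.limitSlopes, e₁ ≠ z * e₀) :
    ∃ n, ∃ c > 0, ∀ z ∈ C.level n, c ≤ |z * e₀ - e₁| := by
  have hcont : Continuous fun z : ℝ => |z * e₀ - e₁| := by fun_prop
  have hclosed : IsClosed {z : ℝ | z * e₀ = e₁} := isClosed_eq (by fun_prop) continuous_const
  -- If every level contained a slope of `e`, the nested compact intersection would contain a limit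
  -- slope of `e`.
  obtain ⟨n, hn⟩ : ∃ n, ¬ (C.level n ∩ {z | z * e₀ = e₁}).Nonempty := by
    by_contra! hcon
    obtain ⟨z, hz⟩ := IsCompact.nonempty_iInter_of_sequence_nonempty_isCompact_isClosed
      (fun n => C.level n ∩ {z | z * e₀ = e₁})
      (fun n => inter_subset_inter_left _ (C.antitone_level n.le_succ)) hcon
      ((C.isCompact_level 0).inter_right hclosed)
      (fun n => (C.isCompact_level n).isClosed.inter hclosed)
    rw [mem_iInter] at hz
    exact he z (mem_iInter.2 fun n => (hz n).1) (hz 0).2.symm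
  obtain ⟨c, hc, h⟩ := (C.isCompact_level n).exists_forall_le' hcont.continuousOn (a := 0)
    (fun z hz => abs_pos.2 (sub_ne_zero.2 fun h => hn ⟨z, hz, h⟩))
  exact ⟨n, c, hc, h⟩

/-- The pieces are cylinders of size about `R`. Thinness and transversality give the Lipschitz
bound, the projection condition gives the interval, and `exists_width` gives the length. It is
essential that `K` is chosen before `ρ`. -/
theorem exists_graphPiece (hC : ∀ i, C.mat i = coordMatrix b (S.lin i : Plane →L[ℝ] Plane))
    {E : Set Plane} (hE : S.IsSelfAffineSet E) (hproj : S.ProjectionCondition E) {e : Circ}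
    (he : ∀ z ∈ C.limitSlopes, b.repr (e : Plane) 1 ≠ z * b.repr (e : Plane) 0) :
    ∃ K ≥ 0, ∀ ρ > 0, ∃ R₀ > 0, ∀ R, 0 < R → R ≤ R₀ → ∀ x ∈ E, ∃ G,
      IsGraphPiece (innerₗ Plane (perp b e)) (innerₗ Plane (e : Plane)) E K (ρ * R) x G ∧
      ∃ y ∈ G, ∃ y' ∈ G, 4 * R ≤ |innerₗ Plane (perp b e) (y - y')| := by
  obtain ⟨n₁, c, hc, htrans⟩ := exists_transversality C he
  obtain ⟨n₀, hn₀⟩ := hproj.2 e (dirLine_notMem_limitOrientations hC he)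
  obtain ⟨η, hη, hwidth⟩ := exists_width hC hE hproj
  obtain ⟨c', hc', hsize⟩ := exists_word_of_size hC hE
  obtain ⟨D, hD0, hD⟩ : ∃ D > 0, ∀ x ∈ E, ∀ y ∈ E, ‖x - y‖ ≤ D := by
    obtain ⟨D, hD⟩ := Metric.isBounded_iff.1 hE.2.1.isBounded
    exact ⟨max D 1, by positivity, fun x hx y hy => by
      rw [← dist_eq_norm]; exact (hD hx hy).trans (le_max_left _ _)⟩
  set e₀ := b.repr (e : Plane) 0 with he₀
  set e₁ := b.repr (e : Plane) 1 with he₁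
  have hen := norm_eq_of_mem_sphere e
  have he₀1 : |e₀| ≤ 1 := hen ▸ abs_repr_le_norm b (e : Plane) 0
  have he₁1 : |e₁| ≤ 1 := hen ▸ abs_repr_le_norm b (e : Plane) 1
  have hθ := C.θ_pos
  refine ⟨2 / c + 1, by positivity, fun ρ hρ => ?_⟩
  -- A cylinder with entry `p ≥ M * R` has projected width at least `η * c * p ≥ 4R`.
  set M := 4 / (η * c) with hM
  have hM0 : 0 < M := by positivity
  -- From this length on, the thickness `D * θ ^ n * p` is at most `ρ * R`, since `c' * p ≤ M * R`.
  obtain ⟨n₂, hn₂⟩ := exists_pow_lt_of_lt_one (y := C.θ)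
    (by positivity : 0 < ρ * c' / (D * M)) C.θ_lt_one
  set N := max n₀ (max n₁ n₂)
  obtain ⟨r₀, hr₀, H⟩ := hsize N
  refine ⟨r₀ / M, by positivity, fun R hR hR' x hx => ?_⟩
  obtain ⟨w, hwN, hxw, hlow, hup⟩ := H (M * R) (by positivity)
    (by rwa [le_div_iff₀ hM0, mul_comm] at hR') x hx
  set p := |C.word w 0 0|
  have hn₀w : n₀ ≤ w.length := (le_max_left _ _).trans hwN
  have hn₁w : n₁ ≤ w.length := ((le_max_left _ _).trans (le_max_right _ _)).trans hwN
  have hn₂w : n₂ ≤ w.length := ((le_max_right _ _).trans (le_max_right _ _)).trans hwN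
  have hδ : D * (C.θ ^ w.length * p) ≤ ρ * R := by
    have h1 : C.θ ^ w.length ≤ ρ * c' / (D * M) :=
      (pow_le_pow_of_le_one hθ.le C.θ_lt_one.le hn₂w).trans hn₂.le
    calc D * (C.θ ^ w.length * p) ≤ D * (ρ * c' / (D * M) * p) := by
          gcongr
      _ = ρ / M * (c' * p) := by field_simp
      _ ≤ ρ / M * (M * R) := by gcongr
      _ = ρ * R := by field_simp
  set f := C.slopes w 0
  have hf1 : |f| ≤ 1 := abs_slopes_zero_le_one C w
  have hlevel : ∀ z, |z| ≤ C.τ → c ≤ |C.slopes w z * e₀ - e₁| := fun z hz =>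
    htrans _ (C.slopes_mem_level w hz hn₁w)
  have hf := hlevel 0 (by simpa using C.τ_pos.le)
  have hT : ∀ v, innerₗ Plane (perp b e) v = e₀ * b.repr v 1 - e₁ * b.repr v 0 := fun v =>
    inner_perp b e v
  have hh : ∀ v, innerₗ Plane (e : Plane) v = e₀ * b.repr v 0 + e₁ * b.repr v 1 := fun v =>
    inner_eq_repr b e v
  refine ⟨S.mapWord w '' E, ⟨hE.mapWord_image_subset w, hxw, ?_, ?_⟩, ?_⟩
  · rintro _ ⟨y, hy, rfl⟩ _ ⟨y', hy', rfl⟩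
    rw [mapWord_sub, hT, hh]
    set v := S.linWord w (y - y')
    set X := b.repr v 0
    set k := b.repr (y - y') 1 * ((C.word w).det / C.word w 0 0)
    have hk : |k| ≤ ρ * R := by
      refine le_trans ?_ hδ
      rw [abs_mul]
      exact mul_le_mul ((abs_repr_le_norm b _ 1).trans (hD y hy y' hy')) (abs_det_div_le C w)
        (abs_nonneg _) hD0.le
    have hY : b.repr v 1 = f * X + k := repr_linWord_one hC w (y - y')
    rw [hY]
    set t := e₀ * (f * X + k) - e₁ * X
    -- Transversality `c ≤ |f * e₀ - e₁|` lets `T` control the first coordinate `X`, and hence `h`.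
    have ht : (f * e₀ - e₁) * X = t - e₀ * k := by simp only [t]; ring
    have h1 : c * |X| ≤ |t| + ρ * R := by
      calc c * |X| ≤ |f * e₀ - e₁| * |X| := by gcongr
        _ = |t - e₀ * k| := by rw [← abs_mul, ht]
        _ ≤ |t| + |e₀ * k| := abs_sub _ _
        _ ≤ |t| + ρ * R := by
          gcongr
          rw [abs_mul]
          exact (mul_le_of_le_one_left (abs_nonneg _) he₀1).trans hk
    have h2 : |X| ≤ (|t| + ρ * R) / c := by rw [le_div_iff₀ hc]; linarith
    have h3 : e₀ * X + e₁ * (f * X + k) = e₀ * X + (e₁ * f) * X + e₁ * k := by ring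
    have h4 : |e₁ * f| ≤ 1 := by
      rw [abs_mul]; exact mul_le_one₀ he₁1 (abs_nonneg _) hf1
    calc |e₀ * X + e₁ * (f * X + k)| ≤ |e₀ * X| + |(e₁ * f) * X| + |e₁ * k| := by
          rw [h3]; exact abs_add_three _ _ _
      _ ≤ |X| + |X| + ρ * R := by
          refine add_le_add (add_le_add ?_ ?_) ?_
          · rw [abs_mul]; exact mul_le_of_le_one_left (abs_nonneg _) he₀1
          · rw [abs_mul]; exact mul_le_of_le_one_left (abs_nonneg _) h4
          · rw [abs_mul]; exact (mul_le_of_le_one_left (abs_nonneg _) he₁1).trans hk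
      _ ≤ 2 * ((|t| + ρ * R) / c) + (|t| + ρ * R) := by
          have := abs_nonneg t
          linarith
      _ = (2 / c + 1) * (|t| + ρ * R) := by ring
  · intro y hy y' hy' s hs
    obtain ⟨p₁, p₂, -, himg⟩ := hn₀ w hn₀w
    have hTp : ∀ v, innerₗ Plane (perp b e) (projAlong e v) = innerₗ Plane (perp b e) v := by
      intro v
      have h2 : innerₗ Plane (perp b e) (e : Plane) = 0 := by rw [hT, ← he₀, ← he₁]; ring
      rw [projAlong_apply, map_sub, map_smul, h2, smul_zero, sub_zero]
    have hsub : segment ℝ (projAlong e y) (projAlong e y') ⊆ projAlong e '' (S.mapWord w '' E) := by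
      rw [himg]
      exact (convex_segment p₁ p₂).segment_subset (himg ▸ mem_image_of_mem _ hy)
        (himg ▸ mem_image_of_mem _ hy')
    rw [← hTp y, ← hTp y', ← segment_eq_uIcc] at hs
    obtain ⟨u, hu, rfl⟩ := (image_segment ℝ (innerₗ Plane (perp b e)).toAffineMap
      (projAlong e y) (projAlong e y')).superset hs
    obtain ⟨g, hg, rfl⟩ := hsub hu
    exact ⟨g, hg, (hTp g).symm⟩
  -- The pair `(b₀, b₁)` represents the functional `T ∘ A_w`.
  · set b₀ := e₀ * C.word w 1 0 - e₁ * C.word w 0 0 with hb₀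
    set b₁ := e₀ * C.word w 1 1 - e₁ * C.word w 0 1 with hb₁
    have hfac : ∀ z, |z| ≤ C.τ →
        b₀ + b₁ * z = (C.word w 0 0 + C.word w 0 1 * z) * (C.slopes w z * e₀ - e₁) := by
      intro z hz
      have h := C.denom_ne_zero w hz
      rw [ConeSystem.slopes, slopeMap, hb₀, hb₁]
      field_simp
      ring
    -- By `hfac` and transversality the functional has no zero `(1, z)` with `|z| ≤ τ`, so
    -- `exists_width` applies to it.
    have hcone : C.τ * |b₁| ≤ |b₀| := by
      by_contra hcon
      rw [not_le] at hcon
      have hb₁0 : b₁ ≠ 0 := by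
        rintro h
        rw [h, abs_zero, mul_zero] at hcon
        exact absurd hcon (not_lt.2 (abs_nonneg _))
      have hz : |-(b₀ / b₁)| ≤ C.τ := by
        rw [abs_neg, abs_div, div_le_iff₀ (abs_pos.2 hb₁0)]; exact hcon.le
      have h := hfac _ hz
      have h0 : b₀ + b₁ * -(b₀ / b₁) = 0 := by field_simp; ring
      rw [h0, eq_comm, mul_eq_zero] at h
      rcases h with h | h
      · exact C.denom_ne_zero w hz h
      · have := hlevel _ hz
        rw [h, abs_zero] at this
        linarith
    have hb₀p : c * p ≤ |b₀| := by
      have := hfac 0 (by simpa using C.τ_pos.le)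
      rw [mul_zero, mul_zero, add_zero, add_zero] at this
      rw [this, abs_mul, mul_comm]
      exact mul_le_mul_of_nonneg_left hf (abs_nonneg _)
    obtain ⟨y, hy, y', hy', hyy⟩ := hwidth b₀ b₁ hcone
    refine ⟨_, mem_image_of_mem _ hy, _, mem_image_of_mem _ hy', ?_⟩
    rw [mapWord_sub, hT, repr_linWord hC, repr_linWord hC]
    have e1 : e₀ * (C.word w 1 0 * b.repr (y - y') 0 + C.word w 1 1 * b.repr (y - y') 1)
        - e₁ * (C.word w 0 0 * b.repr (y - y') 0 + C.word w 0 1 * b.repr (y - y') 1)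
        = b₀ * b.repr (y - y') 0 + b₁ * b.repr (y - y') 1 := by rw [hb₀, hb₁]; ring
    rw [e1]
    refine le_trans ?_ hyy
    calc 4 * R = η * (c * (M * R)) := by rw [hM]; field_simp
      _ ≤ η * |b₀| := by
        gcongr
        exact (mul_le_mul_of_nonneg_left hlow hc.le).trans hb₀p

/-- The dimensions of the visible part in a direction that is not a limit direction. -/
theorem dim_visiblePart_eq_one
    (hC : ∀ i, C.mat i = coordMatrix b (S.lin i : Plane →L[ℝ] Plane))
    {E : Set Plane} (hE : S.IsSelfAffineSet E) (hproj : S.ProjectionCondition E) {e : Circ}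
    (he : ∀ z ∈ C.limitSlopes, b.repr (e : Plane) 1 ≠ z * b.repr (e : Plane) 0) :
    dimH (visiblePart e E) = 1 ∧ assouadDim (visiblePart e E) = 1 := by
  obtain ⟨K, hK, H⟩ := exists_graphPiece hC hE hproj he
  have hsub := visiblePart_subset e E
  have hen := norm_eq_of_mem_sphere e
  have hT : ∀ v, |innerₗ Plane (perp b e) v| ≤ ‖v‖ := fun v => by
    simpa [norm_perp b hen] using abs_real_inner_le_norm (perp b e) v
  have hh : ∀ v, |innerₗ Plane (e : Plane) v| ≤ ‖v‖ := fun v => by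
    simpa [hen] using abs_real_inner_le_norm (e : Plane) v
  have hTh : ∀ v, ‖v‖ ≤ |innerₗ Plane (perp b e) v| + |innerₗ Plane (e : Plane) v| := fun v => by
    rw [← sq_le_sq₀ (norm_nonneg _) (by positivity), norm_sq_eq_inner_perp b hen v, add_sq,
      sq_abs, sq_abs]
    change _ ≤ inner ℝ (perp b e) v ^ 2 + _ + inner ℝ (e : Plane) v ^ 2
    have := mul_nonneg (abs_nonneg (innerₗ Plane (perp b e) v))
      (abs_nonneg (innerₗ Plane (e : Plane) v))
    linarith
  have hupper : assouadDim (visiblePart e E) ≤ 1 := by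
    set K' := K ^ 2 + 3 * K + 2
    have hK' : 0 < K' := by positivity
    refine assouadDim_le_one_of_linear_cover (hE.2.1.totallyBounded.subset hsub)
      (C := 2 * (2 * (K + 2) * K' + 1)) fun ρ hρ hρ1 => ?_
    -- Dividing by `K'` absorbs the factor by which the covering lemma enlarges the radii.
    obtain ⟨R₀, hR₀, H'⟩ := H (ρ / K') (by positivity)
    refine ⟨R₀, hR₀, fun R hR hR' x _ => ?_⟩
    obtain ⟨t, h1, h2, h3⟩ := exists_finset_cover_of_graphPieces hT hh hTh hsub
      (fun x hx g hg h => inner_le_of_mem_visiblePart b hx hg h) (x₀ := x) hK hR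
      (by positivity : 0 < ρ / K') (H' R hR hR')
    refine ⟨t, h1, ?_, h3.trans ?_⟩
    · rwa [← mul_assoc, mul_div_cancel₀ _ hK'.ne'] at h2
    · have : 1 ≤ 1 / ρ := by rw [le_div_iff₀ hρ]; linarith
      calc 2 * (2 * (K + 2) / (ρ / K') + 1) ≤ 2 * (2 * (K + 2) / (ρ / K') + 1 / ρ) := by gcongr
        _ = 2 * (2 * (K + 2) * K' + 1) / ρ := by field_simp
  have hlower : 1 ≤ dimH (visiblePart e E) := by
    obtain ⟨R₀, hR₀, H'⟩ := H 1 one_pos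
    obtain ⟨x, hx⟩ := hE.1
    obtain ⟨G, hG, y, hy, y', hy', hyy⟩ := H' R₀ hR₀ le_rfl x hx
    have hne : innerₗ Plane (perp b e) y ≠ innerₗ Plane (perp b e) y' := fun h => by
      rw [map_sub, h, sub_self, abs_zero] at hyy
      linarith
    -- Any point of the graph piece can be exchanged for a visible point with the same projection,
    -- so the 1-Lipschitz image of the visible part contains an interval.
    have himg : uIcc (innerₗ Plane (perp b e) y) (innerₗ Plane (perp b e) y')
        ⊆ innerSL ℝ (perp b e) '' visiblePart e E := by
      intro s hs
      obtain ⟨g, hg, rfl⟩ := hG.exists_eq y hy y' hy' s hs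
      obtain ⟨z, hz, hzg⟩ := exists_mem_visiblePart b e hE.2.1 (hG.subset hg)
      exact ⟨z, hz, hzg⟩
    have hint : (interior (uIcc (innerₗ Plane (perp b e) y)
        (innerₗ Plane (perp b e) y'))).Nonempty := by
      rw [uIcc, interior_Icc, nonempty_Ioo]
      exact inf_lt_sup.2 hne
    calc (1 : ℝ≥0∞) = dimH (uIcc (innerₗ Plane (perp b e) y) (innerₗ Plane (perp b e) y')) := by
          rw [Real.dimH_of_nonempty_interior hint]; simp
      _ ≤ dimH (innerSL ℝ (perp b e) '' visiblePart e E) := dimH_mono himg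
      _ ≤ dimH (visiblePart e E) := (innerSL ℝ (perp b e)).lipschitz.dimH_image_le _
  have hle := dimH_le_assouadDim (hE.2.1.isBounded.subset hsub)
  exact ⟨le_antisymm (hle.trans hupper) hlower, le_antisymm hupper (hlower.trans hle)⟩

end System

end SelfAffine

theorem corollary4p4 {κ : ℕ} (S : SelfAffine.AffineIFS κ) (E : Set SelfAffine.Plane)
    (hE : S.IsSelfAffineSet E) (hproj : S.ProjectionCondition E)
    (hcone : S.StrongConeSeparation) :
    ∀ᵐ e : SelfAffine.Circ ∂((volume : Measure SelfAffine.Plane).toSphere),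
      dimH (SelfAffine.visiblePart e E) = 1 ∧
      SelfAffine.assouadDim (SelfAffine.visiblePart e E) = 1 := by
  obtain ⟨b, C, hC⟩ := hcone.exists_coneSystem
  filter_upwards [SelfAffine.ae_forall_slope_ne b C.isClosed_limitSlopes C.volume_limitSlopes]
    with e he
  exact SelfAffine.dim_visiblePart_eq_one hC hE hproj he
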